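/- Let $Q$ be a finite-dimensional smooth manifold, $k\ge 1$ an integer, and let $T^mQ$ be the $m$th-order tangent bundle of $Q$, i.e. the manifold of $m$-jets at $0$ of smooth curves in $Q$, with natural coordinates $(q_0^A,\dots,q_m^A)$ and canonical projections $\rho^m_r\colon T^mQ\to T^rQ$ ($r\le m$). Let $\mathcal L\in C^\infty(T^kQ)$ be a Lagrangian of order $k$, with Lagrangian $1$-form $$\theta_{\mathcal L}=\sum_{r=1}^k(-1)^{r-1}\frac1{r!}\,d_T^{\,r-1}\,d_{J_r}\mathcal L\in\Omega^1(T^{2k-1}Q),$$ where forms are pulled back to $T^{2k-1}Q$ by the canonical projections; $J_r=\sum_{i=0}^{k-r}\frac{(r+i)!}{i!}\,dq_i^A\otimes\partial/\partial q_{r+i}^A$ is the $r$th vertical endomorphism of $T(T^kQ)$, $d_{J_r}\mathcal L=d\mathcal L\circ J_r$, and $d_T$ is Tulczyjew's derivation, the derivation with $d_Tf=\sum_i q_{i+1}^A\,\partial f/\partial q_i^A$ and $d_T(dq_i^A)=dq_{i+1}^A$ (summation over repeated indices). Let $\mathcal{FL}\colon T^{2k-1}Q\to T^*(T^{k-1}Q)$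 be the Legendre–Ostrogradsky map of $\mathcal L$, i.e. the map over $T^{k-1}Q$ determined by $$\theta_{\mathcal L}(u)=\big\langle \mathcal{FL}(p),\,T\rho^{2k-1}_{k-1}(u)\big\rangle ,\qquad p\in T^{2k-1}Q,\ u\in T_p(T^{2k-1}Q).$$ Let $\mathcal W=T^{2k-1}Q\times_{T^{k-1}Q}T^*(T^{k-1}Q)$ be the fibre product, with projections $\mathrm{pr}_1\colon\mathcal W\to T^{2k-1}Q$ and $\mathrm{pr}_2\colon\mathcal W\to T^*(T^{k-1}Q)$, and let $$\mathcal W_o=\mathrm{graph}\,\mathcal{FL}=\{w\in\mathcal W:\ \mathrm{pr}_2(w)=\mathcal{FL}(\mathrm{pr}_1(w))\},\qquad j_o\colon\mathcal W_o\hookrightarrow\mathcal W.$$ Then $\mathcal W_o$ is an embedded smooth submanifold of $\mathcal W$, and for any smooth manifold structure on $\mathcal W_o$ (with the subspace topology) for which $j_o$ is a smooth embedding, the map $\overline{\mathrm{pr}}_1=\mathrm{pr}_1\circ j_o\colon\mathcal W_o\to T^{2k-1}Q$ is a diffeomorphism. -/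

import Mathlib

open scoped Manifold ContDiff Bundle Topology
open Set Filter

set_option linter.unusedSectionVars false

noncomputable section

namespace HigherOrder

universe u v

variable (E : Type u) [NormedAddCommGroup E] [NormedSpace ℝ E]
  (Q : Type v) [TopologicalSpace Q] [ChartedSpace E Q]

/-- Smooth curves in the manifold `Q`, which is modelled on the vector space `E`. -/
abbrev Curve : Type v := C^∞⟮𝓘(ℝ, ℝ), ℝ; 𝓘(ℝ, E), Q⟯

/-- The `k`-jet equivalence relation at `0` on curves: same value at `0` and, in the preferred chart
at that value, the same derivatives at `0` up to order `k` (by `jet_eq_of_curveCoord` and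
`curveCoord_eq_of_jet` below any other chart of the atlas gives the same relation). -/
def jetSetoid (k : ℕ) : Setoid (Curve E Q) where
  r σ τ := σ 0 = τ 0 ∧ ∀ i ≤ k,
    iteratedDeriv i (chartAt E (σ 0) ∘ σ) 0 = iteratedDeriv i (chartAt E (σ 0) ∘ τ) 0
  iseqv :=
    { refl := fun _ => ⟨rfl, fun _ _ => rfl⟩
      symm := fun {σ τ} h => ⟨h.1.symm, fun i hi => by rw [← h.1]; exact (h.2 i hi).symm⟩
      trans := fun {σ τ υ} h h' => ⟨h.1.trans h'.1, fun i hi => by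
        rw [h.2 i hi]; have := h'.2 i hi; rw [← h.1] at this; exact this⟩ }

/-- The `k`th-order tangent bundle `T^k Q`: the `k`-jets at `0` of smooth curves in `Q`. -/
def Jet (k : ℕ) : Type v := Quotient (jetSetoid E Q k)

variable {E Q}

/-- The `k`-jet at `0` of a curve. -/
def jet (k : ℕ) (σ : Curve E Q) : Jet E Q k := Quotient.mk (jetSetoid E Q k) σ

namespace Jet

/-- The projection `β^k : T^k Q → Q`, `[σ] ↦ σ 0`. -/
def base {k : ℕ} (p : Jet E Q k) : Q :=
  Quotient.lift (fun σ : Curve E Q => σ 0) (fun _ _ (h : (jetSetoid E Q k).r _ _) => h.1) p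

/-- The canonical projection `ρ^k_r : T^k Q → T^r Q`, for `r ≤ k`. -/
def proj {k r : ℕ} (h : r ≤ k) (p : Jet E Q k) : Jet E Q r :=
  Quotient.lift (fun σ : Curve E Q => jet r σ)
    (fun _ _ (hs : (jetSetoid E Q k).r _ _) => Quotient.sound ⟨hs.1, fun i hi => hs.2 i (hi.trans h)⟩) p

end Jet

/-- The model vector space `E^(k+1)` of `T^k Q`, with elements `(q_0, …, q_k)`. -/
abbrev JetModel (E : Type u) (k : ℕ) : Type u := Fin (k + 1) → E

/-- The derivatives `q_i = (e ∘ σ)^(i)(0)`, `0 ≤ i ≤ k`, of a curve in the chart `e`. -/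
def curveCoord (k : ℕ) (e : OpenPartialHomeomorph Q E) (σ : Curve E Q) : JetModel E k :=
  fun i => iteratedDeriv i (e ∘ σ) 0

/-- The natural coordinates `(q_0, …, q_k)` of a `k`-jet induced by the chart `e` of `Q`. -/
def jetCoord (k : ℕ) (e : OpenPartialHomeomorph Q E) (p : Jet E Q k) : JetModel E k :=
  curveCoord k e p.out

theorem jet_eq_iff {k : ℕ} {σ τ : Curve E Q} : jet k σ = jet k τ ↔ σ 0 = τ 0 ∧ ∀ i ≤ k,
    iteratedDeriv i (chartAt E (σ 0) ∘ σ) 0 = iteratedDeriv i (chartAt E (σ 0) ∘ τ) 0 :=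
  ⟨fun h => Quotient.exact h, fun h => Quotient.sound h⟩

@[simp] theorem base_jet {k : ℕ} (σ : Curve E Q) : (jet k σ).base = σ 0 := rfl
@[simp] theorem proj_jet {k r : ℕ} (h : r ≤ k) (σ : Curve E Q) : (jet k σ).proj h = jet r σ := rfl
@[simp] theorem base_proj {k r : ℕ} (h : r ≤ k) (p : Jet E Q k) : (p.proj h).base = p.base := by
  induction p using Quotient.ind; rfl
theorem jet_out {k : ℕ} (p : Jet E Q k) : jet k p.out = p := Quotient.out_eq p
theorem out_zero {k : ℕ} (p : Jet E Q k) : (p.out : Curve E Q) 0 = p.base := by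
  conv_rhs => rw [← jet_out p]
  rfl

/-- The map induced by `ψ` on `k`-jets of curves (formula of Faà di Bruno). -/
def prolong (k : ℕ) (ψ : E → E) (q : JetModel E k) : JetModel E k := fun i =>
  ∑ c : OrderedFinpartition (i : ℕ), iteratedFDeriv ℝ c.length ψ (q 0) fun j =>
    q ⟨c.partSize j, by have := c.partSize_le j; omega⟩

section manifold
variable [IsManifold 𝓘(ℝ, E) ∞ Q]

theorem contDiffAt_curve {e : OpenPartialHomeomorph Q E} (he : e ∈ atlas E Q) (σ : Curve E Q)
    {t : ℝ} (h : σ t ∈ e.source) : ContDiffAt ℝ ∞ (e ∘ σ) t := by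
  rw [← contMDiffAt_iff_contDiffAt]
  have h1 := contMDiffOn_of_mem_maximalAtlas (I := 𝓘(ℝ, E)) (n := ∞)
    (IsManifold.subset_maximalAtlas (n := ∞) (I := 𝓘(ℝ, E)) he)
  exact (h1.contMDiffAt (e.open_source.mem_nhds h)).comp t σ.contMDiff.contMDiffAt

theorem contDiffOn_transition {e e' : OpenPartialHomeomorph Q E} (he : e ∈ atlas E Q)
    (he' : e' ∈ atlas E Q) : ContDiffOn ℝ ∞ (e' ∘ e.symm) (e.symm.trans e').source := by
  have := (contDiffGroupoid ∞ 𝓘(ℝ, E)).compatible he he'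
  rw [contDiffGroupoid, mem_groupoid_of_pregroupoid] at this
  simpa [contDiffPregroupoid] using this.1

theorem isOpen_transition (e e' : OpenPartialHomeomorph Q E) : IsOpen (e.symm.trans e').source :=
  (e.symm.trans e').open_source

theorem curveCoord_transition (k : ℕ) {e e' : OpenPartialHomeomorph Q E} (he : e ∈ atlas E Q)
    (he' : e' ∈ atlas E Q) (σ : Curve E Q) (h : σ 0 ∈ e.source) (h' : σ 0 ∈ e'.source) :
    curveCoord k e' σ = prolong k (e' ∘ e.symm) (curveCoord k e σ) := by
  have hmem : e (σ 0) ∈ (e.symm.trans e').source := by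
    simp [h, h']
  have h1 : (e' ∘ σ) =ᶠ[𝓝 0] ((e' ∘ e.symm) ∘ (e ∘ σ)) := by
    have : ∀ᶠ t in 𝓝 (0 : ℝ), σ t ∈ e.source :=
      σ.contMDiff.continuous.continuousAt.eventually (e.open_source.mem_nhds h)
    filter_upwards [this] with t ht
    simp [e.left_inv ht]
  funext i
  unfold curveCoord prolong
  rw [h1.iteratedDeriv_eq, iteratedDeriv_vcomp_eq_sum_orderedFinpartition (n := ∞)
    (((contDiffOn_transition he he').contDiffAt ((isOpen_transition e e').mem_nhds hmem)))
    (contDiffAt_curve he σ h) (by exact_mod_cast le_top)]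
  simp

theorem jet_eq_of_curveCoord {k : ℕ} {e : OpenPartialHomeomorph Q E} (he : e ∈ atlas E Q)
    {σ τ : Curve E Q} (hσ : σ 0 ∈ e.source) (hτ : τ 0 ∈ e.source)
    (h : curveCoord k e σ = curveCoord k e τ) : jet k σ = jet k τ := by
  have h0 : σ 0 = τ 0 := by
    have := congrFun h 0
    simp only [curveCoord, Fin.val_zero, iteratedDeriv_zero, Function.comp] at this
    exact e.injOn hσ hτ this
  refine jet_eq_iff.2 ⟨h0, fun i hi => ?_⟩
  have h1 := curveCoord_transition k he (chart_mem_atlas E (σ 0)) σ hσ (mem_chart_source _ _)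
  have h2 := curveCoord_transition k he (chart_mem_atlas E (σ 0)) τ hτ
    (by rw [← h0]; exact mem_chart_source _ _)
  rw [h, ← h2] at h1
  exact congrFun h1 ⟨i, by omega⟩

theorem curveCoord_eq_of_jet {k : ℕ} {e : OpenPartialHomeomorph Q E} (he : e ∈ atlas E Q)
    {σ τ : Curve E Q} (hσ : σ 0 ∈ e.source) (h : jet k σ = jet k τ) :
    curveCoord k e σ = curveCoord k e τ := by
  obtain ⟨h0, h1⟩ := jet_eq_iff.1 h
  rw [curveCoord_transition k (chart_mem_atlas E (σ 0)) he σ (mem_chart_source _ _) hσ,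
    curveCoord_transition k (chart_mem_atlas E (σ 0)) he τ
    (by rw [← h0]; exact mem_chart_source _ _) (h0 ▸ hσ)]
  congr 1
  funext i
  exact h1 i (by omega)

theorem jetCoord_jet {k : ℕ} {e : OpenPartialHomeomorph Q E} (he : e ∈ atlas E Q)
    {σ : Curve E Q} (hσ : σ 0 ∈ e.source) : jetCoord k e (jet k σ) = curveCoord k e σ := by
  refine (curveCoord_eq_of_jet he hσ ?_).symm
  exact (jet_out _).symm

/-- Every `(q_0, …, q_k)` with `q_0` in the range of the chart `e` comes from a smooth curve. -/
theorem exists_curve (k : ℕ) {e : OpenPartialHomeomorph Q E} (he : e ∈ atlas E Q)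
    (q : JetModel E k) (hq : q 0 ∈ e.target) :
    ∃ σ : Curve E Q, σ 0 ∈ e.source ∧ curveCoord k e σ = q := by
  obtain ⟨ε, hε, hball⟩ := Metric.isOpen_iff.1 e.open_target (q 0) hq
  set P : ℝ → E := fun t => ∑ j : Fin (k + 1), (t ^ (j : ℕ)) • ((Nat.factorial j : ℝ)⁻¹ • q j)
    with hP
  have hPs : ContDiff ℝ ∞ P := by
    rw [hP]; fun_prop
  have hP0 : P 0 = q 0 := by
    simp only [hP]
    rw [Finset.sum_eq_single 0]
    · simp
    · intro b _ hb
      have : (b : ℕ) ≠ 0 := fun h => hb (Fin.ext h)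
      simp [this]
    · simp
  have hPi : ∀ i : Fin (k + 1), iteratedDeriv i P 0 = q i := by
    intro i
    have : iteratedDeriv i P 0 = ∑ j : Fin (k + 1),
        iteratedDeriv i (fun t : ℝ => (t ^ (j : ℕ)) • ((Nat.factorial j : ℝ)⁻¹ • q j)) 0 := by
      rw [hP, iteratedDeriv_fun_sum]
      intro j _
      fun_prop
    rw [this, Finset.sum_eq_single i]
    · have hf : (Nat.factorial i : ℝ) ≠ 0 := by positivity
      rw [iteratedDeriv_smul_const (n := (i : ℕ)) (x := (0 : ℝ))
        (f := fun t : ℝ => t ^ (i : ℕ)) (by fun_prop), iteratedDeriv_pow]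
      simp [Nat.descFactorial_self, smul_smul, hf]
    · intro j _ hj
      have hji : (j : ℕ) ≠ i := fun h => hj (Fin.ext h)
      rw [iteratedDeriv_smul_const (n := (i : ℕ)) (x := (0 : ℝ))
        (f := fun t : ℝ => t ^ (j : ℕ)) (by fun_prop), iteratedDeriv_pow]
      rcases lt_or_gt_of_ne hji with h | h
      · simp [Nat.descFactorial_eq_zero_iff_lt.2 h]
      · simp [Nat.sub_ne_zero_of_lt h]
    · simp
  obtain ⟨δ, hδ, hδP⟩ := Metric.continuous_iff.1 hPs.continuous 0 ε hε
  let χ : ContDiffBump (0 : ℝ) := ⟨δ / 2, δ, by positivity, by linarith⟩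
  let c : ℝ → E := fun t => q 0 + χ t • (P t - q 0)
  have hc : ContDiff ℝ ∞ c := by
    exact contDiff_const.add (χ.contDiff.smul (hPs.sub contDiff_const))
  have hcmem : ∀ t, c t ∈ e.target := by
    intro t
    by_cases ht : dist t 0 < δ
    · apply hball
      have h1 := hδP t ht
      rw [hP0, dist_eq_norm] at h1
      rw [Metric.mem_ball, dist_eq_norm]
      simp only [c, add_sub_cancel_left, norm_smul, Real.norm_eq_abs, abs_of_nonneg (χ.nonneg)]
      calc _ ≤ 1 * ‖P t - q 0‖ := by gcongr; exact χ.le_one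
        _ < ε := by simpa using h1
    · have : χ t = 0 := χ.zero_of_le_dist (by simpa using ht)
      simp [c, this, hq]
  have hcP : c =ᶠ[𝓝 0] P := by
    filter_upwards [χ.eventuallyEq_one] with t ht
    simp only [Pi.one_apply] at ht
    simp [c, ht]
  have hσ : ContMDiff 𝓘(ℝ, ℝ) 𝓘(ℝ, E) ∞ (e.symm ∘ c) := by
    intro t
    have h1 := contMDiffOn_symm_of_mem_maximalAtlas (I := 𝓘(ℝ, E)) (n := ∞)
      (IsManifold.subset_maximalAtlas (n := ∞) (I := 𝓘(ℝ, E)) he)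
    exact (h1.contMDiffAt (e.open_target.mem_nhds (hcmem t))).comp t hc.contMDiff.contMDiffAt
  refine ⟨⟨e.symm ∘ c, hσ⟩, e.map_target (hcmem 0), ?_⟩
  funext i
  have : (e ∘ (e.symm ∘ c)) = c := by
    funext t; simp [e.right_inv (hcmem t)]
  change iteratedDeriv i (e ∘ (e.symm ∘ c)) 0 = q i
  rw [this, hcP.iteratedDeriv_eq, hPi]

/-- The natural chart of `T^k Q` induced by a chart `e` of `Q`, with domain `(β^k)⁻¹(dom e)`. -/
def jetChart (k : ℕ) (e : OpenPartialHomeomorph Q E) (he : e ∈ atlas E Q) :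
    PartialEquiv (Jet E Q k) (JetModel E k) where
  toFun := jetCoord k e
  invFun q := open Classical in
    if h : q 0 ∈ e.target then jet k (exists_curve k he q h).choose
    else jet k (ContMDiffMap.const (e.symm (q 0)))
  source := {p | p.base ∈ e.source}
  target := {q | q 0 ∈ e.target}
  map_source' p hp := by
    have : jetCoord k e p 0 = e p.base := by simp [jetCoord, curveCoord, out_zero]
    rw [mem_ofPred_eq, this]; exact e.map_source hp
  map_target' q hq := by
    rw [mem_ofPred_eq] at hq
    rw [dif_pos hq]
    exact (exists_curve k he q hq).choose_spec.1
  left_inv' p hp := by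
    have hq : jetCoord k e p 0 ∈ e.target := by
      have : jetCoord k e p 0 = e p.base := by simp [jetCoord, curveCoord, out_zero]
      rw [this]; exact e.map_source hp
    rw [dif_pos hq]
    conv_rhs => rw [← jet_out p]
    have h := (exists_curve k he _ hq).choose_spec
    exact jet_eq_of_curveCoord he h.1 (by rw [out_zero]; exact hp) h.2
  right_inv' q hq := by
    rw [mem_ofPred_eq] at hq
    rw [dif_pos hq]
    have h := (exists_curve k he q hq).choose_spec
    rw [jetCoord_jet he h.1, h.2]

theorem jetCoord_zero {k : ℕ} (e : OpenPartialHomeomorph Q E) (p : Jet E Q k) :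
    jetCoord k e p 0 = e p.base := by simp [jetCoord, curveCoord, out_zero]

theorem jetCoord_transition (k : ℕ) {e e' : OpenPartialHomeomorph Q E} (he : e ∈ atlas E Q)
    (he' : e' ∈ atlas E Q) (p : Jet E Q k) (h : p.base ∈ e.source) (h' : p.base ∈ e'.source) :
    jetCoord k e' p = prolong k (e' ∘ e.symm) (jetCoord k e p) := by
  rw [← out_zero] at h h'
  exact curveCoord_transition k he he' _ h h'

theorem base_jetChart_symm {k : ℕ} {e : OpenPartialHomeomorph Q E} (he : e ∈ atlas E Q)
    {q : JetModel E k} (hq : q 0 ∈ e.target) : ((jetChart k e he).symm q).base = e.symm (q 0) := by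
  have h1 := (jetChart k e he).map_target (x := q) hq
  have h2 : jetCoord k e ((jetChart k e he).symm q) = q := (jetChart k e he).right_inv hq
  have h3 := jetCoord_zero e ((jetChart k e he).symm q)
  rw [h2] at h3
  rw [h3]; exact (e.left_inv h1).symm

theorem jetChart_trans_source {k : ℕ} {e e' : OpenPartialHomeomorph Q E} (he : e ∈ atlas E Q)
    (he' : e' ∈ atlas E Q) : ((jetChart k e he).symm.trans (jetChart k e' he')).source =
      {q | q 0 ∈ (e.symm.trans e').source} := by
  ext q
  rw [PartialEquiv.trans_source]
  simp only [mem_inter_iff, mem_preimage, mem_ofPred_eq, OpenPartialHomeomorph.trans_source,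
    OpenPartialHomeomorph.symm_source]
  refine and_congr_right fun hq => ?_
  change ((jetChart k e he).symm q).base ∈ e'.source ↔ _
  rw [base_jetChart_symm he hq]

theorem isOpen_jetChart_trans_source {k : ℕ} {e e' : OpenPartialHomeomorph Q E}
    (he : e ∈ atlas E Q) (he' : e' ∈ atlas E Q) :
    IsOpen ((jetChart k e he).symm.trans (jetChart k e' he')).source := by
  rw [jetChart_trans_source]
  exact (isOpen_transition e e').preimage (continuous_apply 0)

theorem eqOn_jetChart_trans {k : ℕ} {e e' : OpenPartialHomeomorph Q E} (he : e ∈ atlas E Q)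
    (he' : e' ∈ atlas E Q) : EqOn ((jetChart k e he).symm.trans (jetChart k e' he'))
      (prolong k (e' ∘ e.symm)) ((jetChart k e he).symm.trans (jetChart k e' he')).source := by
  intro q hq
  rw [jetChart_trans_source] at hq
  have hq1 : q 0 ∈ e.target := hq.1
  have hq2 : e.symm (q 0) ∈ e'.source := hq.2
  have := jetCoord_transition k he he' ((jetChart k e he).symm q)
    ((jetChart k e he).map_target (x := q) hq1) (by rwa [base_jetChart_symm he hq1])
  have h2 : jetCoord k e ((jetChart k e he).symm q) = q := (jetChart k e he).right_inv hq1
  rw [h2] at this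
  exact this

theorem contDiffOn_prolong {k : ℕ} {e e' : OpenPartialHomeomorph Q E} (he : e ∈ atlas E Q)
    (he' : e' ∈ atlas E Q) : ContDiffOn ℝ ∞ (prolong k (e' ∘ e.symm))
      {q | q 0 ∈ (e.symm.trans e').source} := by
  intro q hq
  apply ContDiffAt.contDiffWithinAt
  rw [contDiffAt_pi]
  intro i
  unfold prolong
  apply ContDiffAt.sum
  intro c _
  have h1 : ContDiffAt ℝ ∞ (iteratedFDeriv ℝ c.length (e' ∘ e.symm)) (q 0) :=
    ((contDiffOn_transition he he').contDiffAt
      ((isOpen_transition e e').mem_nhds hq)).iteratedFDeriv_right (m := ∞) (by exact_mod_cast le_top)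
  have h2 : ContDiffAt ℝ ∞ (fun q : JetModel E k => iteratedFDeriv ℝ c.length (e' ∘ e.symm) (q 0))
      q := h1.comp q (f := fun q : JetModel E k => q 0) (by fun_prop)
  have h3 : ContDiffAt ℝ ∞ (fun q : JetModel E k => fun j =>
      q ⟨c.partSize j, by have := c.partSize_le j; omega⟩) q := by fun_prop
  have h4 := (ContinuousLinearMap.continuousMultilinearMapOption (𝕜 := ℝ)
    (ContinuousLinearMap.id ℝ (E [×c.length]→L[ℝ] E))).contDiff (n := ∞)
  have h5 := h4.contDiffAt.comp q (contDiffAt_pi.2 fun _ => h2.prodMk h3)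
  exact h5

variable (E Q) in
/-- The atlas of natural charts of `T^k Q`; it defines the topology and the smooth structure. -/
def jetCore (k : ℕ) : ChartedSpaceCore (JetModel E k) (Jet E Q k) where
  atlas := {f | ∃ (e : OpenPartialHomeomorph Q E) (he : e ∈ atlas E Q), f = jetChart k e he}
  chartAt p := jetChart k (chartAt E p.base) (chart_mem_atlas E p.base)
  mem_chart_source p := mem_chart_source E p.base
  chart_mem_atlas p := ⟨_, _, rfl⟩
  open_source := by
    rintro _ _ ⟨e, he, rfl⟩ ⟨e', he', rfl⟩
    exact isOpen_jetChart_trans_source he he'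
  continuousOn_toFun := by
    rintro _ _ ⟨e, he, rfl⟩ ⟨e', he', rfl⟩
    refine ContinuousOn.congr ?_ (eqOn_jetChart_trans he he')
    rw [jetChart_trans_source]
    exact (contDiffOn_prolong he he').continuousOn

instance (k : ℕ) : TopologicalSpace (Jet E Q k) := (jetCore E Q k).toTopologicalSpace

instance (k : ℕ) : ChartedSpace (JetModel E k) (Jet E Q k) := (jetCore E Q k).toChartedSpace

instance (k : ℕ) : IsManifold 𝓘(ℝ, JetModel E k) ∞ (Jet E Q k) := by
  apply isManifold_of_contDiffOn
  intro f f' hf hf'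
  obtain ⟨_, ⟨⟨g, rfl⟩, hg⟩⟩ := hf
  obtain ⟨_, ⟨⟨g', rfl⟩, hg'⟩⟩ := hf'
  simp only [mem_iUnion, mem_singleton_iff] at hg hg'
  obtain ⟨⟨e, he, rfl⟩, rfl⟩ := hg
  obtain ⟨⟨e', he', rfl⟩, rfl⟩ := hg'
  have hs : 𝓘(ℝ, JetModel E k).symm ⁻¹' ((((jetCore E Q k).openPartialHomeomorph
      (jetChart k e he) ⟨e, he, rfl⟩).symm.trans ((jetCore E Q k).openPartialHomeomorph
      (jetChart k e' he') ⟨e', he', rfl⟩)).source) ∩ range 𝓘(ℝ, JetModel E k) =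
      {q : JetModel E k | q 0 ∈ (e.symm.trans e').source} := by
    simp only [modelWithCornersSelf_coe_symm, preimage_id_eq, id_eq, modelWithCornersSelf_coe,
      range_id, inter_univ]
    exact jetChart_trans_source he he'
  refine ContDiffOn.congr_mono (contDiffOn_prolong he he') ?_ hs.subset
  intro q hq
  refine eqOn_jetChart_trans he he' ?_
  rw [jetChart_trans_source]
  exact hs.subset hq


theorem jet_chartAt_apply {k : ℕ} (p x : Jet E Q k) :
    chartAt (JetModel E k) p x = jetCoord k (chartAt E p.base) x := rfl

theorem jet_chartAt_source {k : ℕ} (p : Jet E Q k) :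
    (chartAt (JetModel E k) p).source = {x | x.base ∈ (chartAt E p.base).source} := rfl

theorem jetCoord_proj {k r : ℕ} (h : r ≤ k) {e : OpenPartialHomeomorph Q E} (he : e ∈ atlas E Q)
    (p : Jet E Q k) (hp : p.base ∈ e.source) :
    jetCoord r e (p.proj h) = fun i : Fin (r + 1) => jetCoord k e p ⟨i, by omega⟩ := by
  have h1 : p.proj h = jet r p.out := by
    conv_lhs => rw [← jet_out p]
    rfl
  rw [h1, jetCoord_jet he (by rwa [out_zero])]
  rfl

/-- Forgetting the coordinates of order greater than `r`. -/
def truncL {k r : ℕ} (h : r ≤ k) : JetModel E k →L[ℝ] JetModel E r :=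
  ContinuousLinearMap.pi fun i : Fin (r + 1) =>
    ContinuousLinearMap.proj (R := ℝ) (φ := fun _ : Fin (k + 1) => E) ⟨i, by omega⟩

theorem chart_proj {k r : ℕ} (h : r ≤ k) (p x : Jet E Q k)
    (hx : x ∈ (chartAt (JetModel E k) p).source) :
    chartAt (JetModel E r) (p.proj h) (x.proj h) = truncL h (chartAt (JetModel E k) p x) := by
  rw [jet_chartAt_apply, jet_chartAt_apply, base_proj]
  exact jetCoord_proj h (chart_mem_atlas E _) x hx

theorem contMDiff_proj {k r : ℕ} (h : r ≤ k) : ContMDiff 𝓘(ℝ, JetModel E k) 𝓘(ℝ, JetModel E r) ∞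
    (Jet.proj h : Jet E Q k → Jet E Q r) := by
  intro p
  have h1 : ContMDiffAt 𝓘(ℝ, JetModel E k) 𝓘(ℝ, JetModel E k) ∞ (chartAt (JetModel E k) p) p :=
    (contMDiffOn_chart (I := 𝓘(ℝ, JetModel E k))).contMDiffAt
      ((chartAt (JetModel E k) p).open_source.mem_nhds (mem_chart_source _ p))
  have h2 : ContMDiffAt 𝓘(ℝ, JetModel E r) 𝓘(ℝ, JetModel E r) ∞
      (chartAt (JetModel E r) (p.proj h)).symm (truncL h (chartAt (JetModel E k) p p)) := by
    refine (contMDiffOn_chart_symm (I := 𝓘(ℝ, JetModel E r))).contMDiffAt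
      ((chartAt (JetModel E r) (p.proj h)).open_target.mem_nhds ?_)
    rw [← chart_proj h p p (mem_chart_source _ p)]
    exact (chartAt (JetModel E r) (p.proj h)).map_source (mem_chart_source _ _)
  have h3 : ContMDiffAt 𝓘(ℝ, JetModel E k) 𝓘(ℝ, JetModel E r) ∞
      (truncL h : JetModel E k →L[ℝ] JetModel E r) (chartAt (JetModel E k) p p) :=
    (ContinuousLinearMap.contDiff (𝕜 := ℝ) (E := JetModel E k) (F := JetModel E r)
      (truncL h)).contMDiff.contMDiffAt
  refine ((h2.comp _ h3).comp p h1).congr_of_eventuallyEq ?_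
  filter_upwards [(chartAt (JetModel E k) p).open_source.mem_nhds (mem_chart_source _ p)] with x hx
  simp only [Function.comp]
  rw [← chart_proj h p x hx, OpenPartialHomeomorph.left_inv]
  change (x.proj h).base ∈ (chartAt E (p.proj h).base).source
  rw [base_proj, base_proj]
  exact hx

/-- The canonical projection `ρ^k_r`, as a smooth map. -/
def projMap {k r : ℕ} (h : r ≤ k) :
    C^∞⟮𝓘(ℝ, JetModel E k), Jet E Q k; 𝓘(ℝ, JetModel E r), Jet E Q r⟯ :=
  ⟨Jet.proj h, contMDiff_proj h⟩

theorem mfderiv_proj {k r : ℕ} (h : r ≤ k) (p : Jet E Q k) :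
    mfderiv 𝓘(ℝ, JetModel E k) 𝓘(ℝ, JetModel E r) (Jet.proj h) p =
      (truncL h : JetModel E k →L[ℝ] JetModel E r) := by
  have hd : MDifferentiableAt 𝓘(ℝ, JetModel E k) 𝓘(ℝ, JetModel E r) (Jet.proj h) p :=
    (contMDiff_proj h).mdifferentiableAt (by simp)
  rw [hd.mfderiv]
  simp only [modelWithCornersSelf_coe, range_id, fderivWithin_univ]
  have : writtenInExtChartAt 𝓘(ℝ, JetModel E k) 𝓘(ℝ, JetModel E r) p (Jet.proj h)
      =ᶠ[𝓝 (extChartAt 𝓘(ℝ, JetModel E k) p p)] (truncL h : JetModel E k →L[ℝ] JetModel E r) := by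
    have hm : (chartAt (JetModel E k) p).target ∈ 𝓝 (extChartAt 𝓘(ℝ, JetModel E k) p p) := by
      refine (chartAt (JetModel E k) p).open_target.mem_nhds ?_
      exact (chartAt (JetModel E k) p).map_source (mem_chart_source _ p)
    filter_upwards [hm] with q hq
    simp only [writtenInExtChartAt, extChartAt, OpenPartialHomeomorph.extend,
      modelWithCornersSelf_partialEquiv, PartialEquiv.trans_refl, Function.comp]
    have := chart_proj h p ((chartAt (JetModel E k) p).symm q)
      ((chartAt (JetModel E k) p).map_target hq)
    rw [OpenPartialHomeomorph.right_inv _ hq] at this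
    exact this
  rw [this.fderiv_eq]
  exact ContinuousLinearMap.fderiv (𝕜 := ℝ) (E := JetModel E k) (F := JetModel E r) (truncL h)

/-- The translated curve `s ↦ σ (s + t)`. -/
def translate (σ : Curve E Q) (t : ℝ) : Curve E Q :=
  ⟨fun s => σ (s + t), σ.contMDiff.comp (contDiff_id.add contDiff_const).contMDiff⟩

/-- The canonical lifting `t ↦ j^k_0 (σ(· + t))` of a curve `σ` to `T^k Q`. -/
def curveLift (k : ℕ) (σ : Curve E Q) (t : ℝ) : Jet E Q k := jet k (translate σ t)

variable (E Q) in
/-- The canonical injection `j_{m+1} : T^(m+1) Q → T(T^m Q)`: the velocity at `0` of the canonical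
lifting to `T^m Q` of a curve representing the given jet. The two lemmas below show that it does not
depend on the representative: in natural coordinates it is
`(q_0, …, q_{m+1}) ↦ (q_0, …, q_m; q_1, …, q_{m+1})`. -/
def canonicalInjection (m : ℕ) (p : Jet E Q (m + 1)) :
    TangentBundle 𝓘(ℝ, JetModel E m) (Jet E Q m) :=
  tangentMap 𝓘(ℝ, ℝ) 𝓘(ℝ, JetModel E m) (curveLift m p.out) ⟨0, (1 : ℝ)⟩

theorem jetCoord_curveLift (k : ℕ) {e : OpenPartialHomeomorph Q E} (he : e ∈ atlas E Q)
    (σ : Curve E Q) (t : ℝ) (h : σ t ∈ e.source) :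
    jetCoord k e (curveLift k σ t) = fun i : Fin (k + 1) => iteratedDeriv i (e ∘ σ) t := by
  unfold curveLift
  rw [jetCoord_jet he (by simpa [translate] using h)]
  funext i
  have : (e ∘ translate σ t) = fun s => (e ∘ σ) (s + t) := rfl
  simp only [curveCoord, this]
  rw [iteratedDeriv_comp_add_const]
  simp

theorem translate_zero (σ : Curve E Q) : translate σ 0 = σ := by
  ext s; simp [translate]

theorem canonicalInjection_fst (m : ℕ) (p : Jet E Q (m + 1)) :
    (canonicalInjection E Q m p).1 = p.proj (Nat.le_succ m) := by
  change curveLift m p.out 0 = _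
  rw [curveLift, translate_zero]
  conv_rhs => rw [← jet_out p]
  rfl

theorem contDiffAt_coord {e : OpenPartialHomeomorph Q E} (he : e ∈ atlas E Q) (k : ℕ)
    (σ : Curve E Q) {t : ℝ} (h : σ t ∈ e.source) :
    ContDiffAt ℝ ∞ (fun t => fun i : Fin (k + 1) => iteratedDeriv i (e ∘ σ) t) t := by
  rw [contDiffAt_pi]
  intro i
  have h1 := (contDiffAt_curve he σ h).iteratedFDeriv_right (m := ∞) (i := (i : ℕ))
    (by exact_mod_cast le_top)
  rw [show (fun t => iteratedDeriv i (e ∘ σ) t) = _ from iteratedDeriv_eq_equiv_comp]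
  exact (LinearIsometryEquiv.contDiff _).contDiffAt.comp t h1

theorem canonicalInjection_snd (m : ℕ) (p : Jet E Q (m + 1)) :
    ((canonicalInjection E Q m p).2 : JetModel E m) =
      fun i => jetCoord (m + 1) (chartAt E p.base) p i.succ := by
  set σ : Curve E Q := p.out with hσ
  set e := chartAt E p.base with he
  have hea : e ∈ atlas E Q := chart_mem_atlas E _
  have h0 : σ 0 ∈ e.source := by rw [out_zero]; exact mem_chart_source _ _
  have hnear : ∀ᶠ t in 𝓝 (0 : ℝ), σ t ∈ e.source :=
    σ.contMDiff.continuous.continuousAt.eventually (e.open_source.mem_nhds h0)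
  have hfst : curveLift m σ 0 = p.proj (Nat.le_succ m) := canonicalInjection_fst m p
  have hbase : (curveLift m σ 0).base = p.base := by rw [hfst, base_proj]
  have hchart : ∀ᶠ t in 𝓝 (0 : ℝ), chartAt (JetModel E m) (curveLift m σ 0) (curveLift m σ t) =
      fun i : Fin (m + 1) => iteratedDeriv i (e ∘ σ) t := by
    filter_upwards [hnear] with t ht
    rw [jet_chartAt_apply, hbase]
    exact jetCoord_curveLift m hea σ t ht
  have hcd := contDiffAt_coord hea m σ h0
  have hsm : ContMDiffAt 𝓘(ℝ, ℝ) 𝓘(ℝ, JetModel E m) ∞ (curveLift m σ) 0 := by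
    have h2 : ContMDiffAt 𝓘(ℝ, JetModel E m) 𝓘(ℝ, JetModel E m) ∞
        (chartAt (JetModel E m) (curveLift m σ 0)).symm
        ((fun t => fun i : Fin (m + 1) => iteratedDeriv i (e ∘ σ) t) 0) := by
      refine (contMDiffOn_chart_symm (I := 𝓘(ℝ, JetModel E m))).contMDiffAt
        ((chartAt (JetModel E m) (curveLift m σ 0)).open_target.mem_nhds ?_)
      have := hchart.self_of_nhds
      simp only at this ⊢
      rw [← this]
      exact (chartAt (JetModel E m) _).map_source (mem_chart_source _ _)
    refine (h2.comp (0 : ℝ) hcd.contMDiffAt).congr_of_eventuallyEq ?_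
    filter_upwards [hchart, hnear] with t ht ht'
    simp only [Function.comp]
    rw [← ht, OpenPartialHomeomorph.left_inv]
    change (σ (0 + t)) ∈ (chartAt E (curveLift m σ 0).base).source
    rw [hbase, zero_add]; exact ht'
  change mfderiv 𝓘(ℝ, ℝ) 𝓘(ℝ, JetModel E m) (curveLift m σ) 0 (1 : ℝ) = _
  rw [(hsm.mdifferentiableAt (by simp)).mfderiv]
  simp only [modelWithCornersSelf_coe, range_id, fderivWithin_univ]
  have : writtenInExtChartAt 𝓘(ℝ, ℝ) 𝓘(ℝ, JetModel E m) 0 (curveLift m σ)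
      =ᶠ[𝓝 (0 : ℝ)] (fun t => fun i : Fin (m + 1) => iteratedDeriv i (e ∘ σ) t) := by
    filter_upwards [hchart] with t ht
    rw [← ht]
    rfl
  have h2 : ∀ i : Fin (m + 1), DifferentiableAt ℝ (fun t => iteratedDeriv i (e ∘ σ) t) (0 : ℝ) :=
    fun i => differentiableAt_pi.1 (hcd.differentiableAt (by simp)) i
  rw [show extChartAt 𝓘(ℝ, ℝ) (0 : ℝ) 0 = 0 from rfl, this.fderiv_eq]
  have h3 := (hasDerivAt_pi.2 fun i => (h2 i).hasDerivAt).hasFDerivAt.fderiv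
  rw [h3]
  funext i
  have h4 := congrFun (jetCoord_curveLift (m + 1) hea σ 0 h0) i.succ
  rw [curveLift, translate_zero, hσ, jet_out] at h4
  rw [h4]
  rw [Fin.val_succ, iteratedDeriv_succ]
  change (1 : ℝ) • deriv (iteratedDeriv i (e ∘ σ)) 0 = _
  rw [one_smul]


variable (E Q) in
/-- Differential 1-forms on `T^k Q` (smoothness is not bundled). A tangent vector of `T^k Q` at `p` is
represented by its components `(v_0, …, v_k)` in the natural coordinates induced by the preferred
chart of `Q` at `β^k(p)`; this is the meaning of `TangentSpace` for the atlas of `T^k Q`. -/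
abbrev OneForm (k : ℕ) : Type _ :=
  ∀ p : Jet E Q k, TangentSpace 𝓘(ℝ, JetModel E k) p →L[ℝ] ℝ

/-- The `r`th vertical endomorphism `J_r` of `T(T^k Q)`, with natural local expression
`J_r = ∑_i ((r+i)!/i!) dq_i ⊗ ∂/∂q_{r+i}`, i.e. the components of order less than `r` of
`J_r v` are `0` and the one of order `j ≥ r` is `(j!/(j-r)!) v_{j-r}`. -/
def verticalEndo {k : ℕ} (r : ℕ) (p : Jet E Q k) :
    TangentSpace 𝓘(ℝ, JetModel E k) p →L[ℝ] TangentSpace 𝓘(ℝ, JetModel E k) p :=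
  show JetModel E k →L[ℝ] JetModel E k from
  ContinuousLinearMap.pi fun j : Fin (k + 1) =>
    if r ≤ (j : ℕ) then ((Nat.factorial j : ℝ) / (Nat.factorial ((j : ℕ) - r) : ℝ)) •
      ContinuousLinearMap.proj (R := ℝ) (φ := fun _ : Fin (k + 1) => E) ⟨(j : ℕ) - r, by omega⟩
    else 0

/-- The `r`th vertical differential of a function, `d_{J_r} f = J_r^* (df) = df ∘ J_r`. -/
def verticalDiff {k : ℕ} (r : ℕ) (f : Jet E Q k → ℝ) : OneForm E Q k := fun p =>
  ContinuousLinearMap.comp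
    (show TangentSpace 𝓘(ℝ, JetModel E k) p →L[ℝ] ℝ from mfderiv 𝓘(ℝ, JetModel E k) 𝓘(ℝ, ℝ) f p)
    (verticalEndo r p)

/-- Tulczyjew's derivation on (scalar or vector-valued) functions on `T^m Q`:
`(d_T f)(p) = d_{ρ(p)} f (j_{m+1}(p))`. -/
def totalDeriv {F : Type*} [NormedAddCommGroup F] [NormedSpace ℝ F] {m : ℕ} (f : Jet E Q m → F) :
    Jet E Q (m + 1) → F := fun p =>
  mfderiv 𝓘(ℝ, JetModel E m) 𝓘(ℝ, F) f (canonicalInjection E Q m p).1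
    (canonicalInjection E Q m p).2

/-- The map `(v_0, …, v_{m+1}) ↦ (v_1, …, v_{m+1})`. -/
def shiftL {m : ℕ} : JetModel E (m + 1) →L[ℝ] JetModel E m :=
  ContinuousLinearMap.pi fun i : Fin (m + 1) =>
    ContinuousLinearMap.proj (R := ℝ) (φ := fun _ : Fin (m + 2) => E) i.succ

/-- The coefficients `a(x) = (a_0(x), …, a_m(x))` of a 1-form `θ = ∑_i a_i dq_i` in the natural
coordinates induced by the preferred chart of `Q` at the base point of `x₀`; as a linear form,
`a(x) w = ∑_i a_i(x) w_i`. Only `x` in the domain of that chart matter. -/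
def formCoeff {m : ℕ} (θ : OneForm E Q m) (x₀ x : Jet E Q m) : JetModel E m →L[ℝ] ℝ :=
  ContinuousLinearMap.comp (show JetModel E m →L[ℝ] ℝ from θ x)
    (tangentCoordChange 𝓘(ℝ, JetModel E m) x₀ x x)

/-- Tulczyjew's derivation on 1-forms: the derivation with `d_T (dq_i) = dq_{i+1}`, that is,
`d_T (∑_i a_i dq_i) = ∑_i (d_T a_i) dq_i + a_i dq_{i+1}` in natural coordinates around `p`. -/
def formDeriv {m : ℕ} (θ : OneForm E Q m) : OneForm E Q (m + 1) := fun p =>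
  show JetModel E (m + 1) →L[ℝ] ℝ from
  (totalDeriv (formCoeff θ (p.proj (Nat.le_succ m))) p).comp (truncL (Nat.le_succ m)) +
    (formCoeff θ (p.proj (Nat.le_succ m)) (p.proj (Nat.le_succ m))).comp shiftL

/-- The iterate `d_T^s` on 1-forms. -/
def formDerivIter {m : ℕ} (θ : OneForm E Q m) : (s : ℕ) → OneForm E Q (m + s)
  | 0 => θ
  | s + 1 => formDeriv (formDerivIter θ s)

/-- The pullback `(ρ^k_r)^* θ` of a 1-form. -/
def pullbackForm {k r : ℕ} (h : r ≤ k) (θ : OneForm E Q r) : OneForm E Q k := fun p =>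
  (θ (p.proj h)).comp (mfderiv 𝓘(ℝ, JetModel E k) 𝓘(ℝ, JetModel E r) (Jet.proj h) p)

/-- The Lagrangian 1-form on `T^(2k-1) Q`,
`θ_L = ∑_{r=1}^k (-1)^(r-1) (1/r!) d_T^(r-1) d_{J_r} L` (here `r = i + 1`), where each summand, a form on
`T^(k+r-1) Q`, is pulled back to `T^(2k-1) Q`. -/
def lagrangianForm {k : ℕ} (L : Jet E Q k → ℝ) : OneForm E Q (2 * k - 1) :=
  ∑ i : Fin k, ((-1 : ℝ) ^ (i : ℕ) * ((Nat.factorial (i + 1) : ℝ))⁻¹) •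
    pullbackForm (by omega) (formDerivIter (verticalDiff (i + 1) L) i)

/-- The form vanishes on the vectors `v` with `v_0 = … = v_{j-1} = 0`; for `1 ≤ j ≤ k` these are the
vertical vectors of `ρ^k_{j-1}`. -/
def IsSemibasic {k : ℕ} (j : ℕ) (θ : OneForm E Q k) : Prop :=
  ∀ (p : Jet E Q k) (v : JetModel E k), (∀ i : Fin (k + 1), (i : ℕ) < j → v i = 0) → θ p v = 0

theorem verticalEndo_apply {k : ℕ} (r : ℕ) (p : Jet E Q k) (v : JetModel E k) (j : Fin (k + 1)) :
    (verticalEndo r p v : JetModel E k) j = if r ≤ (j : ℕ) then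
      ((Nat.factorial j : ℝ) / (Nat.factorial ((j : ℕ) - r) : ℝ)) • v ⟨(j : ℕ) - r, by omega⟩ else 0 := by
  change (if r ≤ (j : ℕ) then ((Nat.factorial j : ℝ) / (Nat.factorial ((j : ℕ) - r) : ℝ)) •
      ContinuousLinearMap.proj (R := ℝ) (φ := fun _ : Fin (k + 1) => E) ⟨(j : ℕ) - r, by omega⟩
    else 0) v = _
  split_ifs <;> rfl

theorem isSemibasic_verticalDiff {k : ℕ} (r : ℕ) (f : Jet E Q k → ℝ) :
    IsSemibasic (k + 1 - r) (verticalDiff r f) := by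
  intro p v hv
  have : verticalEndo r p v = (0 : JetModel E k) := by
    funext j
    rw [verticalEndo_apply]
    split_ifs with h
    · have : v ⟨(j : ℕ) - r, by omega⟩ = 0 := hv _ (by simp; omega)
      simp [this]
    · simp
  change (mfderiv 𝓘(ℝ, JetModel E k) 𝓘(ℝ, ℝ) f p) (verticalEndo r p v) = 0
  rw [this]
  exact map_zero _

theorem fderiv_prolong_zero {k : ℕ} {e e' : OpenPartialHomeomorph Q E} (he : e ∈ atlas E Q)
    (he' : e' ∈ atlas E Q) {q : JetModel E k} (hq : q 0 ∈ (e.symm.trans e').source) {j : ℕ}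
    {v : JetModel E k} (hv : ∀ i : Fin (k + 1), (i : ℕ) < j → v i = 0) (i : Fin (k + 1))
    (hi : (i : ℕ) < j) : fderiv ℝ (prolong k (e' ∘ e.symm)) q v i = 0 := by
  have hd : DifferentiableAt ℝ (prolong k (e' ∘ e.symm)) q :=
    ((contDiffOn_prolong he he').contDiffAt (((isOpen_transition e e').preimage
      (continuous_apply (0 : Fin (k + 1)))).mem_nhds hq)).differentiableAt (by simp)
  have h1 : HasDerivAt (fun s : ℝ => prolong k (e' ∘ e.symm) (q + s • v) i)
      (fderiv ℝ (prolong k (e' ∘ e.symm)) q v i) 0 := by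
    have h2 : HasDerivAt (fun s : ℝ => q + s • v) v 0 := by
      simpa using ((hasDerivAt_id (0 : ℝ)).smul_const v).const_add q
    have h3 : HasFDerivAt (prolong k (e' ∘ e.symm)) (fderiv ℝ (prolong k (e' ∘ e.symm)) q)
        (q + (0 : ℝ) • v) := by simpa using hd.hasFDerivAt
    exact hasDerivAt_pi.1 (h3.comp_hasDerivAt (0 : ℝ) h2) i
  have h4 : (fun s : ℝ => prolong k (e' ∘ e.symm) (q + s • v) i) =
      fun _ => prolong k (e' ∘ e.symm) q i := by
    funext s
    unfold prolong
    refine Finset.sum_congr rfl fun c _ => ?_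
    have h0 : v 0 = 0 := hv 0 (by simp; omega)
    have h5 : ∀ l : Fin c.length, v ⟨c.partSize l, by have := c.partSize_le l; omega⟩ = 0 :=
      fun l => hv _ (by have := c.partSize_le l; simp; omega)
    simp [h0, h5]
  rw [h4] at h1
  exact h1.unique (hasDerivAt_const _ _)

theorem tangentCoordChange_zero {k : ℕ} (x₀ x : Jet E Q k)
    (hx : x ∈ (chartAt (JetModel E k) x₀).source) {j : ℕ} {v : JetModel E k}
    (hv : ∀ i : Fin (k + 1), (i : ℕ) < j → v i = 0) (i : Fin (k + 1)) (hi : (i : ℕ) < j) :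
    (tangentCoordChange 𝓘(ℝ, JetModel E k) x₀ x x v : JetModel E k) i = 0 := by
  rw [tangentCoordChange_def]
  simp only [modelWithCornersSelf_coe, range_id, fderivWithin_univ]
  have he := chart_mem_atlas E x₀.base
  have he' := chart_mem_atlas E x.base
  have hq : (jetCoord k (chartAt E x₀.base) x) 0 ∈
      ((chartAt E x₀.base).symm.trans (chartAt E x.base)).source := by
    rw [jetCoord_zero]
    have hx' : x.base ∈ (chartAt E x₀.base).source := hx
    simp [hx']
  have h1 : (extChartAt 𝓘(ℝ, JetModel E k) x ∘ (extChartAt 𝓘(ℝ, JetModel E k) x₀).symm) =ᶠ[𝓝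
      (extChartAt 𝓘(ℝ, JetModel E k) x₀ x)]
      prolong k (chartAt E x.base ∘ (chartAt E x₀.base).symm) := by
    filter_upwards [((isOpen_transition _ _).preimage
      (continuous_apply (0 : Fin (k + 1)))).mem_nhds hq] with q hq
    refine eqOn_jetChart_trans he he' ?_
    rw [jetChart_trans_source]
    exact hq
  rw [h1.fderiv_eq]
  exact fderiv_prolong_zero he he' hq hv i hi

theorem isSemibasic_formDeriv {m j : ℕ} {θ : OneForm E Q m} (hθ : IsSemibasic j θ) :
    IsSemibasic (j + 1) (formDeriv θ) := by
  intro p v hv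
  set x₀ := p.proj (Nat.le_succ m) with hx₀
  have hcoeff : ∀ x ∈ (chartAt (JetModel E m) x₀).source, ∀ w : JetModel E m,
      (∀ i : Fin (m + 1), (i : ℕ) < j → w i = 0) → formCoeff θ x₀ x w = 0 := by
    intro x hx w hw
    exact hθ x _ fun i hi => tangentCoordChange_zero x₀ x hx hw i hi
  have h1 : formCoeff θ x₀ x₀ (shiftL v) = 0 :=
    hcoeff x₀ (mem_chart_source _ _) _ fun i hi => hv i.succ (by simpa using hi)
  have h2 : totalDeriv (formCoeff θ x₀) p (truncL (Nat.le_succ m) v) = 0 := by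
    set w : JetModel E m := truncL (Nat.le_succ m) v with hw
    have hw0 : ∀ i : Fin (m + 1), (i : ℕ) < j → w i = 0 :=
      fun i hi => hv ⟨i, by omega⟩ (by simp; omega)
    unfold totalDeriv
    rw [canonicalInjection_fst, ← hx₀]
    by_cases hA : MDifferentiableAt 𝓘(ℝ, JetModel E m) 𝓘(ℝ, JetModel E m →L[ℝ] ℝ)
        (formCoeff θ x₀) x₀
    · have h3 := ((ContinuousLinearMap.apply ℝ ℝ w :
        (JetModel E m →L[ℝ] ℝ) →L[ℝ] ℝ).hasMFDerivAt (x := formCoeff θ x₀ x₀)).comp x₀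
        hA.hasMFDerivAt
      have h4 : HasMFDerivAt 𝓘(ℝ, JetModel E m) 𝓘(ℝ, ℝ)
          ((ContinuousLinearMap.apply ℝ ℝ w : (JetModel E m →L[ℝ] ℝ) →L[ℝ] ℝ) ∘
            formCoeff θ x₀) x₀ 0 := by
        refine (hasMFDerivAt_const (0 : ℝ) x₀).congr_of_eventuallyEq ?_
        filter_upwards [(chartAt (JetModel E m) x₀).open_source.mem_nhds
          (mem_chart_source _ x₀)] with x hx
        exact hcoeff x hx w hw0
      have h5 := hasMFDerivAt_unique h3 h4
      exact DFunLike.congr_fun (F := JetModel E m →L[ℝ] ℝ) h5 (canonicalInjection E Q m p).2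
    · rw [mfderiv_zero_of_not_mdifferentiableAt hA]
      rfl
  change totalDeriv (formCoeff θ x₀) p (truncL (Nat.le_succ m) v) +
    formCoeff θ x₀ x₀ (shiftL v) = 0
  rw [h1, h2, add_zero]

theorem isSemibasic_pullbackForm {k r j : ℕ} (h : r ≤ k) {θ : OneForm E Q r}
    (hθ : IsSemibasic j θ) : IsSemibasic j (pullbackForm h θ) := by
  intro p v hv
  refine hθ _ (mfderiv 𝓘(ℝ, JetModel E k) 𝓘(ℝ, JetModel E r) (Jet.proj h) p v) fun i hi => ?_
  rw [mfderiv_proj]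
  exact hv _ hi

theorem isSemibasic_formDerivIter {m j : ℕ} {θ : OneForm E Q m} (hθ : IsSemibasic j θ) :
    ∀ s, IsSemibasic (j + s) (formDerivIter θ s)
  | 0 => hθ
  | s + 1 => isSemibasic_formDeriv (isSemibasic_formDerivIter hθ s)

theorem isSemibasic_lagrangianForm {k : ℕ} (L : Jet E Q k → ℝ) :
    IsSemibasic k (lagrangianForm L) := by
  intro p v hv
  have h1 : lagrangianForm L p = ∑ i : Fin k,
      (((-1 : ℝ) ^ (i : ℕ) * ((Nat.factorial (i + 1) : ℝ))⁻¹) •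
      (pullbackForm (k := 2 * k - 1) (by omega)
        (formDerivIter (verticalDiff (i + 1) L) i)) p) := by
    simp only [lagrangianForm, Finset.sum_apply, Pi.smul_apply]
  rw [h1]
  refine (_root_.sum_apply (F := TangentSpace 𝓘(ℝ, JetModel E (2 * k - 1)) p →L[ℝ] ℝ) _ _ _).trans
    (Finset.sum_eq_zero fun i _ => ?_)
  have h2 := isSemibasic_pullbackForm (k := 2 * k - 1) (by omega) (isSemibasic_formDerivIter
    (isSemibasic_verticalDiff (i + 1) L) i) p v (fun l hl => hv l (by omega))
  exact (congrArg (fun t : ℝ => ((-1 : ℝ) ^ (i : ℕ) * ((Nat.factorial (i + 1) : ℝ))⁻¹) • t) h2).trans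
    (smul_zero _)

/-- The map `(v_0, …, v_r) ↦ (v_0, …, v_r, 0, …, 0)`, a section of `truncL` if `r ≤ k`. -/
def extendL {r : ℕ} (k : ℕ) : JetModel E r →L[ℝ] JetModel E k :=
  ContinuousLinearMap.pi fun i : Fin (k + 1) =>
    if h : (i : ℕ) < r + 1 then
      ContinuousLinearMap.proj (R := ℝ) (φ := fun _ : Fin (r + 1) => E) ⟨i, h⟩
    else 0

theorem extendL_apply {r k : ℕ} (v : JetModel E r) (i : Fin (k + 1)) :
    extendL k v i = if h : (i : ℕ) < r + 1 then v ⟨i, h⟩ else 0 := by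
  change (if h : (i : ℕ) < r + 1 then
      ContinuousLinearMap.proj (R := ℝ) (φ := fun _ : Fin (r + 1) => E) ⟨i, h⟩
    else 0) v = _
  split_ifs <;> rfl

theorem truncL_apply {k r : ℕ} (h : r ≤ k) (v : JetModel E k) (i : Fin (r + 1)) :
    truncL h v i = v ⟨i, by omega⟩ := rfl

/-- As `θ_L` is semibasic, at every `p` it comes from a unique covector of `T^(k-1) Q`. -/
theorem existsUnique_legendre {k : ℕ} (L : Jet E Q k → ℝ) (p : Jet E Q (2 * k - 1)) :
    ∃! α : TangentSpace 𝓘(ℝ, JetModel E (k - 1)) (p.proj (r := k - 1) (by omega)) →L[ℝ] ℝ,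
      ∀ u : TangentSpace 𝓘(ℝ, JetModel E (2 * k - 1)) p, lagrangianForm L p u =
        α (mfderiv 𝓘(ℝ, JetModel E (2 * k - 1)) 𝓘(ℝ, JetModel E (k - 1))
          (Jet.proj (by omega)) p u) := by
  have hk : k - 1 ≤ 2 * k - 1 := by omega
  set θp : JetModel E (2 * k - 1) →L[ℝ] ℝ := lagrangianForm L p with hθp
  have hlift : ∀ v : JetModel E (k - 1), truncL hk (extendL (2 * k - 1) v) = v := by
    intro v
    funext i
    rw [truncL_apply, extendL_apply, dif_pos (by simp; omega)]
  refine ⟨θp.comp (extendL (2 * k - 1)), fun u => ?_, fun β hβ => ?_⟩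
  · rw [mfderiv_proj]
    let u' : JetModel E (2 * k - 1) := u
    have h0 := isSemibasic_lagrangianForm L p (u' - extendL (2 * k - 1) (truncL hk u'))
      (fun i hi => by
        rw [Pi.sub_apply, extendL_apply, dif_pos (by omega), truncL_apply]
        exact sub_self _)
    have h1 : θp (u' - extendL (2 * k - 1) (truncL hk u')) = 0 := h0
    rw [map_sub, sub_eq_zero] at h1
    exact h1
  · refine ContinuousLinearMap.ext fun v => ?_
    have h1 := hβ (extendL (2 * k - 1) (v : JetModel E (k - 1)))
    rw [mfderiv_proj] at h1
    have h2 : β (truncL hk (extendL (2 * k - 1) (v : JetModel E (k - 1)))) = β v :=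
      congrArg β (hlift v)
    exact h2.symm.trans h1.symm

variable (E Q) in
/-- The cotangent space of `T^k Q` at `x`. -/
abbrev Cotangent (k : ℕ) (x : Jet E Q k) : Type _ :=
  TangentSpace 𝓘(ℝ, JetModel E k) x →L[ℝ] Bundle.Trivial (Jet E Q k) ℝ x

variable (E Q) in
/-- The cotangent bundle `T^*(T^k Q)`. -/
abbrev CotangentBundle (k : ℕ) : Type _ :=
  Bundle.TotalSpace (JetModel E k →L[ℝ] ℝ) (Cotangent E Q k)

/-- The Legendre–Ostrogradsky map `FL : T^(2k-1) Q → T^*(T^(k-1) Q)`; it is determined by the identity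
in `legendre_spec`. -/
def legendre {k : ℕ} (L : Jet E Q k → ℝ) (p : Jet E Q (2 * k - 1)) : CotangentBundle E Q (k - 1) :=
  ⟨p.proj (by omega), (existsUnique_legendre L p).choose⟩

/-- The defining property of `FL`: `θ_L(u) = ⟨FL(τ(u)), Tρ^(2k-1)_(k-1) u⟩` for `u` tangent to
`T^(2k-1) Q`. -/
theorem legendre_spec {k : ℕ} (L : Jet E Q k → ℝ)
    (u : TangentBundle 𝓘(ℝ, JetModel E (2 * k - 1)) (Jet E Q (2 * k - 1))) :
    lagrangianForm L u.1 u.2 = (legendre L u.1).2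
      (tangentMap 𝓘(ℝ, JetModel E (2 * k - 1)) 𝓘(ℝ, JetModel E (k - 1))
        (Jet.proj (by omega)) u).2 :=
  (existsUnique_legendre L u.1).choose_spec.1 u.2

variable (E Q) in
/-- The unified phase space `W = T^(2k-1) Q ×_{T^(k-1) Q} T^*(T^(k-1) Q)`: the fibre product of the two
bundles, with its structure of (pullback) vector bundle over `T^(2k-1) Q`. -/
abbrev UnifiedSpace (k : ℕ) : Type _ :=
  Bundle.TotalSpace (JetModel E (k - 1) →L[ℝ] ℝ)
    ((projMap (by omega) : C^∞⟮𝓘(ℝ, JetModel E (2 * k - 1)), Jet E Q (2 * k - 1);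
      𝓘(ℝ, JetModel E (k - 1)), Jet E Q (k - 1)⟯) *ᵖ (Cotangent E Q (k - 1)))

/-- The projection `pr₁ : W → T^(2k-1) Q`. -/
def pr₁ {k : ℕ} (w : UnifiedSpace E Q k) : Jet E Q (2 * k - 1) := w.proj

/-- The projection `pr₂ : W → T^*(T^(k-1) Q)`. -/
def pr₂ {k : ℕ} (w : UnifiedSpace E Q k) : CotangentBundle E Q (k - 1) :=
  Bundle.Pullback.lift _ w

/-- `W_o = graph FL`, as a subset of `W`. -/
def legendreGraph {k : ℕ} (L : Jet E Q k → ℝ) : Set (UnifiedSpace E Q k) :=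
  {w | pr₂ w = legendre L (pr₁ w)}

/-- The model (without boundary) of the manifold `W`. -/
abbrev unifiedModel (E : Type u) [NormedAddCommGroup E] [NormedSpace ℝ E] (k : ℕ) :
    ModelWithCorners ℝ (JetModel E (2 * k - 1) × (JetModel E (k - 1) →L[ℝ] ℝ))
      (ModelProd (JetModel E (2 * k - 1)) (JetModel E (k - 1) →L[ℝ] ℝ)) :=
  𝓘(ℝ, JetModel E (2 * k - 1)).prod 𝓘(ℝ, JetModel E (k - 1) →L[ℝ] ℝ)

end manifold
end HigherOrder

end

noncomputable section

namespace HigherOrder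

universe u v

/-! ### Mixed partial derivatives of maps on the plane -/

section calculus
variable {V W : Type*} [NormedAddCommGroup V] [NormedSpace ℝ V] [NormedAddCommGroup W]
  [NormedSpace ℝ W]

/-! A point of `W` over `p` is a covector at `ρ(p)`, so `W` is a vector bundle over `T^(2k-1) Q`,
`FL` amounts to a section `s` of it (`legendreSection`), and the graph is the image of `s`. On the
graph, `pr₁` and `s` are mutually inverse. Once `s` is known to be smooth, the rest is formal: a
smooth section is straightened by a shear in a bundle chart, hence is an immersion; and for any
structure making `j_o` an embedding, the inverse of `pr₁ ∘ j_o` is smooth because it is continuous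
and its composite with the immersion `j_o` is `s`.

The work is the smoothness of `s`, that is, of `θ_L`. Vertical endomorphisms, `d_T` on forms and
tangent vectors themselves are all written at each point in the preferred chart of that point, and
this chart jumps as the point moves. It must be shown that the same formulas give the coefficients
in one fixed chart (`IsSmoothForm`), so that these are visibly smooth. This is naturality under
changes of natural coordinates, which are the prolongations `prolong k ψ`.

Naturality is proved with curves instead of Faà di Bruno sums. A point of the model and a tangent
vector there are the derivatives at `0` of curves `c` and `d`, and the tangent map of the
prolongation yields the derivatives of `t ↦ dψ(c(t)) d(t)` (`fderiv_prolong_derivs`). In this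
picture `J_r` is multiplication of `d` by `t^r`, projection forgets high derivatives, and `d_T` is
`d/dt`. The identities needed are then the Leibniz and chain rules. The delicate one is
`formCoeff_formDeriv`, where a second derivative of the coordinate change appears twice and matches.

Finally, `θ_L` being semibasic, the components of `FL` are the first `k` coefficients of `θ_L`. -/

theorem contDiffOn_fderiv_apply_const {f : V → W} {O : Set V} (hO : IsOpen O)
    (hf : ContDiffOn ℝ ∞ f O) (a : V) : ContDiffOn ℝ ∞ (fun x => fderiv ℝ f x a) O :=
  (hf.fderiv_of_isOpen hO (by simp)).clm_apply contDiffOn_const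

theorem fderiv_fderiv_apply_comm {f : V → W} {x : V} (hf : ContDiffAt ℝ ∞ f x) (a b : V) :
    fderiv ℝ (fun y => fderiv ℝ f y a) x b = fderiv ℝ (fun y => fderiv ℝ f y b) x a := by
  have hd : DifferentiableAt ℝ (fderiv ℝ f) x :=
    (hf.fderiv_right (m := ∞) (by simp)).differentiableAt (by simp)
  have h (c : V) : fderiv ℝ (fun y => fderiv ℝ f y c) x = (fderiv ℝ (fderiv ℝ f) x).flip c := by
    have := (hd.hasFDerivAt.clm_apply (hasFDerivAt_const c x)).fderiv
    rw [this]; ext; simp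
  rw [h, h]
  exact (hf.isSymmSndFDerivAt (by simpa using WithTop.coe_le_coe.2 (le_top : (2 : ℕ∞) ≤ ⊤))) b a

/-- Differentiation in the first variable commutes with iterated differentiation in the second. -/
theorem hasDerivAt_iteratedDeriv_snd {O : Set (ℝ × ℝ)} (hO : IsOpen O) (i : ℕ) :
    ∀ {f : ℝ × ℝ → W}, ContDiffOn ℝ ∞ f O → ∀ {s t : ℝ}, (s, t) ∈ O →
      HasDerivAt (fun s => iteratedDeriv i (fun t => f (s, t)) t)
        (iteratedDeriv i (fun t => fderiv ℝ f (s, t) (1, 0)) t) s := by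
  induction i with
  | zero =>
    intro f hf s t h
    simp only [iteratedDeriv_zero]
    have h1 := ((hf.contDiffAt (hO.mem_nhds h)).differentiableAt (by simp)).hasFDerivAt
    exact h1.comp_hasDerivAt s ((hasDerivAt_id s).prodMk (hasDerivAt_const s t))
  | succ i ih =>
    -- Peeling off the innermost `t`-derivative lets the induction hypothesis, which holds for all
    -- `f`, be applied to `∂f/∂t`; symmetry of second derivatives then exchanges the two partials.
    have key : ∀ {f : ℝ × ℝ → W}, ContDiffOn ℝ ∞ f O → ∀ {s t : ℝ}, (s, t) ∈ O →
        iteratedDeriv (i + 1) (fun t => f (s, t)) t =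
          iteratedDeriv i (fun t => fderiv ℝ f (s, t) (0, 1)) t := by
      intro f hf s t h
      rw [iteratedDeriv_succ']
      refine Filter.EventuallyEq.iteratedDeriv_eq i ?_
      filter_upwards [(hO.preimage (Continuous.prodMk_right s)).mem_nhds h] with t ht
      have h1 := ((hf.contDiffAt (hO.mem_nhds ht)).differentiableAt (by simp)).hasFDerivAt
      exact (h1.comp_hasDerivAt t ((hasDerivAt_const t s).prodMk (hasDerivAt_id t))).deriv
    intro f hf s t h
    have h1 := ih (contDiffOn_fderiv_apply_const hO hf (0, 1)) h
    rw [key (contDiffOn_fderiv_apply_const hO hf (1, 0)) h]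
    have h2 : iteratedDeriv i (fun t => fderiv ℝ (fun x => fderiv ℝ f x (0, 1)) (s, t) (1, 0)) t =
        iteratedDeriv i (fun t => fderiv ℝ (fun x => fderiv ℝ f x (1, 0)) (s, t) (0, 1)) t := by
      refine Filter.EventuallyEq.iteratedDeriv_eq i ?_
      filter_upwards [(hO.preimage (Continuous.prodMk_right s)).mem_nhds h] with t ht
      exact fderiv_fderiv_apply_comm (hf.contDiffAt (hO.mem_nhds ht)) _ _
    rw [← h2]
    refine h1.congr_of_eventuallyEq ?_
    filter_upwards [(hO.preimage (Continuous.prodMk_left t)).mem_nhds h] with s hs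
    exact key hf hs

end calculus

/-! ### Derivatives of curves in the model space and prolongations -/

variable {E : Type u} [NormedAddCommGroup E] [NormedSpace ℝ E]

/-- The derivatives `(c(t), c'(t), …, c^(k)(t))` of a curve in the model space. -/
def derivs (k : ℕ) (c : ℝ → E) (t : ℝ) : JetModel E k := fun i => iteratedDeriv i c t

theorem contDiffAt_iteratedDeriv {c : ℝ → E} {t : ℝ} (hc : ContDiffAt ℝ ∞ c t) (i : ℕ) :
    ContDiffAt ℝ ∞ (iteratedDeriv i c) t := by
  rw [iteratedDeriv_eq_equiv_comp]
  exact (LinearIsometryEquiv.contDiff _).contDiffAt.comp t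
    (hc.iteratedFDeriv_right (m := ∞) (i := i) (by exact_mod_cast le_top))

theorem hasDerivAt_derivs {k : ℕ} {c : ℝ → E} (hc : ContDiff ℝ ∞ c) (t : ℝ) :
    HasDerivAt (derivs k c) (fun i : Fin (k + 1) => derivs (k + 1) c t i.succ) t := by
  refine hasDerivAt_pi.2 fun i => ?_
  have h1 : DifferentiableAt ℝ (iteratedDeriv i c) t :=
    (contDiffAt_iteratedDeriv hc.contDiffAt i).differentiableAt (by simp)
  have := h1.hasDerivAt
  rwa [← iteratedDeriv_succ] at this

theorem derivs_add_smul {k : ℕ} {c d : ℝ → E} (hc : ContDiff ℝ ∞ c) (hd : ContDiff ℝ ∞ d)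
    (s t : ℝ) : derivs k (fun t => c t + s • d t) t = derivs k c t + s • derivs k d t := by
  funext i
  have h1 : ContDiff ℝ i c := hc.of_le (by exact_mod_cast le_top)
  have h2 : ContDiff ℝ i d := hd.of_le (by exact_mod_cast le_top)
  simp only [derivs, Pi.add_apply, Pi.smul_apply]
  rw [iteratedDeriv_fun_add h1.contDiffAt (h2.const_smul s).contDiffAt,
    show iteratedDeriv (i : ℕ) (fun t => s • d t) t = _ from
      iteratedDeriv_const_smul h2.contDiffAt s]

/-- In the Leibniz formula at `0` only the `r`th derivative of `t^r` survives, and `choose j r * r!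
= j! / (j - r)!`. This is the coefficient in `J_r`: on sequences of derivatives, `J_r` is
multiplication of the curve by `t^r`. -/
theorem iteratedDeriv_pow_smul_zero {d : ℝ → E} (hd : ContDiffAt ℝ ∞ d 0) (r j : ℕ) :
    iteratedDeriv j (fun t : ℝ => t ^ r • d t) 0 = if r ≤ j then
      ((Nat.factorial j : ℝ) / (Nat.factorial (j - r) : ℝ)) • iteratedDeriv (j - r) d 0 else 0 := by
  have h1 := iteratedDerivWithin_smul (n := j) (mem_univ (0 : ℝ)) uniqueDiffOn_univ
    (f := fun t : ℝ => t ^ r) (g := d) (by fun_prop)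
    (hd.of_le (by exact_mod_cast le_top)).contDiffWithinAt
  simp only [iteratedDerivWithin_univ, iteratedDeriv_pow] at h1
  rw [show (fun t : ℝ => t ^ r • d t) = (fun t : ℝ => t ^ r) • d from rfl, h1]
  split_ifs with h
  · rw [Finset.sum_eq_single r]
    · rw [Nat.descFactorial_self, ← Nat.choose_mul_factorial_mul_factorial h]
      have := Nat.factorial_ne_zero (j - r)
      simp [← Nat.cast_smul_eq_nsmul ℝ, smul_smul]
      field_simp
    · intro i _ hi
      rcases lt_or_gt_of_ne hi with h' | h'
      · simp [Nat.sub_ne_zero_of_lt h']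
      · simp [Nat.descFactorial_eq_zero_iff_lt.2 h']
    · intro h'
      exact absurd (Finset.mem_range.2 (by omega)) h'
  · refine Finset.sum_eq_zero fun i hi => ?_
    have : i < r := by have := Finset.mem_range.1 hi; omega
    simp [Nat.sub_ne_zero_of_lt this]

/-- Every point of the model of `T^k Q` is the sequence of derivatives of a smooth curve. -/
theorem exists_derivs_eq {k : ℕ} (q : JetModel E k) :
    ∃ c : ℝ → E, ContDiff ℝ ∞ c ∧ derivs k c 0 = q := by
  refine ⟨fun t => ∑ j : Fin (k + 1), (t ^ (j : ℕ)) • ((Nat.factorial j : ℝ)⁻¹ • q j),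
    by fun_prop, ?_⟩
  funext i
  rw [derivs, iteratedDeriv_fun_sum (fun j _ => by fun_prop), Finset.sum_eq_single i]
  · have hf : (Nat.factorial i : ℝ) ≠ 0 := by positivity
    rw [iteratedDeriv_smul_const (n := (i : ℕ)) (x := (0 : ℝ))
      (f := fun t : ℝ => t ^ (i : ℕ)) (by fun_prop), iteratedDeriv_pow]
    simp [Nat.descFactorial_self, smul_smul, hf]
  · intro j _ hj
    have hji : (j : ℕ) ≠ i := fun h => hj (Fin.ext h)
    rw [iteratedDeriv_smul_const (n := (i : ℕ)) (x := (0 : ℝ))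
      (f := fun t : ℝ => t ^ (j : ℕ)) (by fun_prop), iteratedDeriv_pow]
    rcases lt_or_gt_of_ne hji with h | h
    · simp [Nat.descFactorial_eq_zero_iff_lt.2 h]
    · simp [Nat.sub_ne_zero_of_lt h]
  · simp

/-- The identities for prolongations below go through this form of Faà di Bruno's formula and never
expand the sum over partitions. -/
theorem prolong_derivs {k : ℕ} {ψ : E → E} {c : ℝ → E} (hc : ContDiff ℝ ∞ c) {t : ℝ}
    (hψ : ContDiffAt ℝ ∞ ψ (c t)) (i : Fin (k + 1)) :
    prolong k ψ (derivs k c t) i = iteratedDeriv i (fun t => ψ (c t)) t := by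
  have := iteratedDeriv_vcomp_eq_sum_orderedFinpartition (n := ∞) hψ hc.contDiffAt
    (i := i) (by exact_mod_cast le_top)
  rw [show (fun t => ψ (c t)) = ψ ∘ c from rfl, this]
  simp [prolong, derivs]

theorem contDiffAt_prolong {k : ℕ} {ψ : E → E} {q : JetModel E k}
    (hψ : ContDiffAt ℝ ∞ ψ (q 0)) : ContDiffAt ℝ ∞ (prolong k ψ) q := by
  rw [contDiffAt_pi]
  intro i
  unfold prolong
  apply ContDiffAt.sum
  intro c _
  have h1 : ContDiffAt ℝ ∞ (iteratedFDeriv ℝ c.length ψ) (q 0) :=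
    hψ.iteratedFDeriv_right (m := ∞) (by exact_mod_cast le_top)
  have h2 : ContDiffAt ℝ ∞ (fun q : JetModel E k => iteratedFDeriv ℝ c.length ψ (q 0))
      q := h1.comp q (f := fun q : JetModel E k => q 0) (by fun_prop)
  have h3 : ContDiffAt ℝ ∞ (fun q : JetModel E k => fun j =>
      q ⟨c.partSize j, by have := c.partSize_le j; omega⟩) q := by fun_prop
  -- Evaluation `(f, v) ↦ f v` of multilinear maps is the restriction of a continuous multilinear
  -- map to the diagonal, hence smooth.
  have h4 := (ContinuousLinearMap.continuousMultilinearMapOption (𝕜 := ℝ)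
    (ContinuousLinearMap.id ℝ (E [×c.length]→L[ℝ] E))).contDiff (n := ∞)
  exact h4.contDiffAt.comp q (contDiffAt_pi.2 fun _ => h2.prodMk h3)

/-- The tangent map of a prolongation, in terms of curves: the components of the image of the
derivatives of `d` are the derivatives of `t ↦ dψ(c(t)) d(t)`. -/
theorem fderiv_prolong_derivs {k : ℕ} {ψ : E → E} {U : Set E} (hU : IsOpen U)
    (hψ : ContDiffOn ℝ ∞ ψ U) {c d : ℝ → E} (hc : ContDiff ℝ ∞ c) (hd : ContDiff ℝ ∞ d) {t : ℝ}
    (ht : c t ∈ U) (i : Fin (k + 1)) :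
    fderiv ℝ (prolong k ψ) (derivs k c t) (derivs k d t) i =
      iteratedDeriv i (fun t => fderiv ℝ ψ (c t) (d t)) t := by
  -- The variation of `c` in the direction `d`. The `s`-derivative at `0` of the `i`th
  -- `t`-derivative of `ψ ∘ γ` is computed twice: by exchanging the derivatives, and by the chain
  -- rule for `prolong k ψ` along the line through `derivs k c t`.
  set γ : ℝ × ℝ → E := fun x => c x.2 + x.1 • d x.2 with hγ
  have hγs : ContDiff ℝ ∞ γ := by fun_prop
  set O : Set (ℝ × ℝ) := γ ⁻¹' U
  have hO : IsOpen O := hU.preimage hγs.continuous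
  have h0 : ∀ {t}, c t ∈ U → (0, t) ∈ O := fun h => by simpa [O, hγ] using h
  have h1 := hasDerivAt_iteratedDeriv_snd hO i (f := ψ ∘ γ)
    (hψ.comp hγs.contDiffOn fun x hx => hx) (h0 ht)
  have h2 : iteratedDeriv i (fun t => fderiv ℝ (ψ ∘ γ) (0, t) (1, 0)) t =
      iteratedDeriv i (fun t => fderiv ℝ ψ (c t) (d t)) t := by
    refine Filter.EventuallyEq.iteratedDeriv_eq i ?_
    filter_upwards [(hU.preimage hc.continuous).mem_nhds ht] with t ht
    have hγ0 : γ (0, t) = c t := by simp [hγ]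
    have h3 : HasFDerivAt ψ (fderiv ℝ ψ (c t)) (γ (0, t)) := by
      rw [hγ0]
      exact ((hψ.contDiffAt (hU.mem_nhds ht)).differentiableAt (by simp)).hasFDerivAt
    have h4 := (hγs.contDiffAt (x := (0, t))).differentiableAt (by simp) |>.hasFDerivAt
    rw [(h3.comp _ h4).fderiv]
    have h5 : HasDerivAt (fun s : ℝ => γ (s, t)) (fderiv ℝ γ (0, t) (1, 0)) 0 :=
      HasFDerivAt.comp_hasDerivAt (0 : ℝ) (f := fun s : ℝ => (s, t)) h4
        ((hasDerivAt_id (0 : ℝ)).prodMk (hasDerivAt_const (0 : ℝ) t))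
    have h6 : HasDerivAt (fun s : ℝ => γ (s, t)) (d t) 0 := by
      simpa [hγ] using ((hasDerivAt_id (0 : ℝ)).smul_const (d t)).const_add (c t)
    rw [ContinuousLinearMap.comp_apply, h5.unique h6]
  rw [h2] at h1
  refine HasDerivAt.unique ?_ h1
  have h7 : HasDerivAt (fun s : ℝ => derivs k c t + s • derivs k d t) (derivs k d t) 0 := by
    simpa using ((hasDerivAt_id (0 : ℝ)).smul_const (derivs k d t)).const_add (derivs k c t)
  have h8 : HasFDerivAt (prolong k ψ) (fderiv ℝ (prolong k ψ) (derivs k c t))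
      (derivs k c t + (0 : ℝ) • derivs k d t) := by
    have : ContDiffAt ℝ ∞ (prolong k ψ) (derivs k c t) :=
      contDiffAt_prolong (hψ.contDiffAt (hU.mem_nhds (by simpa [derivs] using ht)))
    simpa using (this.differentiableAt (by simp)).hasFDerivAt
  refine (hasDerivAt_pi.1 (h8.comp_hasDerivAt (0 : ℝ) h7) i).congr_of_eventuallyEq ?_
  filter_upwards [(hO.preimage (Continuous.prodMk_left t)).mem_nhds (h0 ht)] with s hs
  rw [Function.comp_apply, ← derivs_add_smul hc hd, prolong_derivs (by fun_prop)
    (hψ.contDiffAt (hU.mem_nhds hs))]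
  rfl

theorem contDiffOn_fderiv_curve {ψ : E → E} {U : Set E} (hU : IsOpen U)
    (hψ : ContDiffOn ℝ ∞ ψ U) {c d : ℝ → E} (hc : ContDiff ℝ ∞ c) (hd : ContDiff ℝ ∞ d) :
    ContDiffOn ℝ ∞ (fun t => fderiv ℝ ψ (c t) (d t)) (c ⁻¹' U) :=
  ((hψ.fderiv_of_isOpen hU (m := ∞) (by simp)).comp hc.contDiffOn fun _ h => h).clm_apply
    hd.contDiffOn

/-- The matrix of the `r`th vertical endomorphism. -/
def verticalL (E : Type u) [NormedAddCommGroup E] [NormedSpace ℝ E] (k r : ℕ) :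
    JetModel E k →L[ℝ] JetModel E k :=
  ContinuousLinearMap.pi fun j : Fin (k + 1) =>
    if r ≤ (j : ℕ) then ((Nat.factorial j : ℝ) / (Nat.factorial ((j : ℕ) - r) : ℝ)) •
      ContinuousLinearMap.proj (R := ℝ) (φ := fun _ : Fin (k + 1) => E) ⟨(j : ℕ) - r, by omega⟩
    else 0

theorem verticalL_apply {k : ℕ} (r : ℕ) (v : JetModel E k) (j : Fin (k + 1)) :
    verticalL E k r v j = if r ≤ (j : ℕ) then
      ((Nat.factorial j : ℝ) / (Nat.factorial ((j : ℕ) - r) : ℝ)) • v ⟨(j : ℕ) - r, by omega⟩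
    else 0 := by
  simp only [verticalL, ContinuousLinearMap.coe_pi']
  split_ifs <;> rfl

/-! ### Naturality of the jet operations under prolongations -/

section model
variable {ψ : E → E} {U : Set E}

/-- The vertical endomorphisms commute with the tangent maps of prolongations. -/
theorem fderiv_prolong_verticalL {k : ℕ} (hU : IsOpen U) (hψ : ContDiffOn ℝ ∞ ψ U)
    {q : JetModel E k} (hq : q 0 ∈ U) (r : ℕ) (v : JetModel E k) :
    fderiv ℝ (prolong k ψ) q (verticalL E k r v) =
      verticalL E k r (fderiv ℝ (prolong k ψ) q v) := by
  obtain ⟨c, hc, rfl⟩ := exists_derivs_eq q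
  obtain ⟨d, hd, rfl⟩ := exists_derivs_eq v
  have hc0 : c 0 ∈ U := by simpa [derivs] using hq
  -- Replacing `d` by `t^r d` realises `J_r`; linearity of `dψ(c(t))` pulls the factor `t^r` out on
  -- the other side.
  have h1 : verticalL E k r (derivs k d 0) = derivs k (fun t => t ^ r • d t) 0 := by
    funext j
    rw [verticalL_apply]
    exact (iteratedDeriv_pow_smul_zero hd.contDiffAt r j).symm
  rw [h1]
  funext j
  rw [fderiv_prolong_derivs hU hψ hc (by fun_prop) hc0, verticalL_apply]
  simp only [map_smul]
  rw [iteratedDeriv_pow_smul_zero ((contDiffOn_fderiv_curve hU hψ hc hd).contDiffAt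
    ((hU.preimage hc.continuous).mem_nhds hc0))]
  split_ifs with h
  · rw [fderiv_prolong_derivs hU hψ hc hd hc0]
  · rfl

theorem truncL_derivs {k r : ℕ} (h : r ≤ k) (c : ℝ → E) (t : ℝ) :
    truncL h (derivs k c t) = derivs r c t := rfl

theorem shiftL_apply {m : ℕ} (v : JetModel E (m + 1)) (i : Fin (m + 1)) :
    shiftL v i = v i.succ := rfl

/-- The reason why `d_T` becomes `d/dt` along curves: the velocity of the lifted curve is the
shifted jet. -/
theorem hasDerivAt_derivs_shiftL {k : ℕ} {c : ℝ → E} (hc : ContDiff ℝ ∞ c) (t : ℝ) :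
    HasDerivAt (derivs k c) (shiftL (derivs (k + 1) c t)) t :=
  hasDerivAt_derivs hc t

/-- Both sides list the derivatives up to order `r` of the same curve `t ↦ dψ(c(t)) d(t)`. -/
theorem truncL_fderiv_prolong {k r : ℕ} (h : r ≤ k) (hU : IsOpen U) (hψ : ContDiffOn ℝ ∞ ψ U)
    {q : JetModel E k} (hq : q 0 ∈ U) (v : JetModel E k) :
    truncL h (fderiv ℝ (prolong k ψ) q v) =
      fderiv ℝ (prolong r ψ) (truncL h q) (truncL h v) := by
  obtain ⟨c, hc, rfl⟩ := exists_derivs_eq q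
  obtain ⟨d, hd, rfl⟩ := exists_derivs_eq v
  have hc0 : c 0 ∈ U := by simpa [derivs] using hq
  funext j
  rw [truncL_derivs, truncL_derivs, truncL_apply, fderiv_prolong_derivs hU hψ hc hd hc0,
    fderiv_prolong_derivs hU hψ hc hd hc0]

/-- Chain rule for `d/dt` of the derivatives of `ψ ∘ c`. It expresses that the canonical injection
looks the same in all natural charts. -/
theorem shiftL_prolong {m : ℕ} (hU : IsOpen U) (hψ : ContDiffOn ℝ ∞ ψ U)
    {q : JetModel E (m + 1)} (hq : q 0 ∈ U) :
    shiftL (prolong (m + 1) ψ q) =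
      fderiv ℝ (prolong m ψ) (truncL (Nat.le_succ m) q) (shiftL q) := by
  obtain ⟨c, hc, rfl⟩ := exists_derivs_eq q
  have hc0 : c 0 ∈ U := by simpa [derivs] using hq
  have hψ0 : ContDiffAt ℝ ∞ ψ (c 0) := hψ.contDiffAt (hU.mem_nhds hc0)
  have h1 : HasFDerivAt (prolong m ψ) (fderiv ℝ (prolong m ψ) (derivs m c 0)) (derivs m c 0) :=
    ((contDiffAt_prolong (k := m) (q := derivs m c 0)
      (by simpa [derivs] using hψ0)).differentiableAt (by simp)).hasFDerivAt
  have h2 := h1.comp_hasDerivAt (0 : ℝ) (hasDerivAt_derivs_shiftL hc 0)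
  rw [truncL_derivs]
  funext i
  refine HasDerivAt.unique ?_ (hasDerivAt_pi.1 h2 i)
  rw [shiftL_apply, prolong_derivs hc hψ0, Fin.val_succ, iteratedDeriv_succ]
  have h3 : (fun t => (prolong m ψ ∘ derivs m c) t i) =ᶠ[𝓝 0]
      iteratedDeriv i (fun t => ψ (c t)) := by
    filter_upwards [(hU.preimage hc.continuous).mem_nhds hc0] with t ht
    exact prolong_derivs hc (hψ.contDiffAt (hU.mem_nhds ht)) i
  refine HasDerivAt.congr_of_eventuallyEq ?_ h3
  exact ((contDiffAt_iteratedDeriv (hψ0.comp (0 : ℝ) hc.contDiffAt) i).differentiableAt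
    (by simp)).hasDerivAt

/-- Product rule for `d/dt` of the prolonged tangent map applied to the derivatives of `d`. The
second-derivative term is the one that a change of coordinates produces when `d_T` acts on the
coefficients of a form. -/
theorem shiftL_fderiv_prolong {m : ℕ} (hU : IsOpen U) (hψ : ContDiffOn ℝ ∞ ψ U)
    {q : JetModel E (m + 1)} (hq : q 0 ∈ U) (v : JetModel E (m + 1)) :
    shiftL (fderiv ℝ (prolong (m + 1) ψ) q v) =
      fderiv ℝ (fderiv ℝ (prolong m ψ)) (truncL (Nat.le_succ m) q) (shiftL q)
          (truncL (Nat.le_succ m) v) +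
        fderiv ℝ (prolong m ψ) (truncL (Nat.le_succ m) q) (shiftL v) := by
  obtain ⟨c, hc, rfl⟩ := exists_derivs_eq q
  obtain ⟨d, hd, rfl⟩ := exists_derivs_eq v
  have hc0 : c 0 ∈ U := by simpa [derivs] using hq
  have h1 : ContDiffAt ℝ ∞ (fderiv ℝ (prolong m ψ)) (derivs m c 0) :=
    (contDiffAt_prolong (k := m) (q := derivs m c 0) (hψ.contDiffAt (hU.mem_nhds
      (by simpa [derivs] using hc0)))).fderiv_right (by simp)
  have h2 := (((h1.differentiableAt (by simp)).hasFDerivAt.comp_hasDerivAt (0 : ℝ)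
    (hasDerivAt_derivs_shiftL hc 0)).clm_apply (hasDerivAt_derivs_shiftL hd 0))
  simp only [truncL_derivs]
  funext i
  refine HasDerivAt.unique ?_ (hasDerivAt_pi.1 h2 i)
  rw [shiftL_apply, fderiv_prolong_derivs hU hψ hc hd hc0, Fin.val_succ, iteratedDeriv_succ]
  have h3 : (fun t => (fderiv ℝ (prolong m ψ) ∘ derivs m c) t (derivs m d t) i) =ᶠ[𝓝 0]
      iteratedDeriv i (fun t => fderiv ℝ ψ (c t) (d t)) := by
    filter_upwards [(hU.preimage hc.continuous).mem_nhds hc0] with t ht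
    exact fderiv_prolong_derivs hU hψ hc hd ht i
  refine HasDerivAt.congr_of_eventuallyEq ?_ h3
  exact ((contDiffAt_iteratedDeriv ((contDiffOn_fderiv_curve hU hψ hc hd).contDiffAt
    ((hU.preimage hc.continuous).mem_nhds hc0)) i).differentiableAt (by simp)).hasDerivAt

end model

/-! ### Passing from preferred charts to a fixed natural chart -/

variable {Q : Type v} [TopologicalSpace Q] [ChartedSpace E Q] [IsManifold 𝓘(ℝ, E) ∞ Q]

theorem contMDiffOn_chart_source_iff {V M F : Type*} [NormedAddCommGroup V] [NormedSpace ℝ V]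
    [TopologicalSpace M] [ChartedSpace V M] [IsManifold 𝓘(ℝ, V) ∞ M]
    [NormedAddCommGroup F] [NormedSpace ℝ F] {f : M → F} {x₀ : M} :
    ContMDiffOn 𝓘(ℝ, V) 𝓘(ℝ, F) ∞ f (chartAt V x₀).source ↔
      ContDiffOn ℝ ∞ (f ∘ (chartAt V x₀).symm) (chartAt V x₀).target := by
  refine ⟨fun h => ?_, fun h => ?_⟩
  · exact (h.comp (contMDiffOn_chart_symm (I := 𝓘(ℝ, V)))
      fun q hq => (chartAt V x₀).map_target hq).contDiffOn
  · refine (h.contMDiffOn.comp (contMDiffOn_chart (I := 𝓘(ℝ, V)))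
      fun q hq => (chartAt V x₀).map_source hq).congr fun q hq => ?_
    simp [(chartAt V x₀).left_inv hq]

/-- `mfderiv` at `x` reads `f` in the preferred chart at `x`, which varies with `x`; the coordinate
change compensates for this, and what remains is an ordinary derivative in the one chart at `x₀`. -/
theorem mfderiv_comp_tangentCoordChange {V M F : Type*} [NormedAddCommGroup V] [NormedSpace ℝ V]
    [TopologicalSpace M] [ChartedSpace V M] [IsManifold 𝓘(ℝ, V) ∞ M]
    [NormedAddCommGroup F] [NormedSpace ℝ F] {f : M → F} {x₀ x : M}
    (hf : MDifferentiableAt 𝓘(ℝ, V) 𝓘(ℝ, F) f x) (hx : x ∈ (chartAt V x₀).source) (v : V) :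
    mfderiv 𝓘(ℝ, V) 𝓘(ℝ, F) f x (tangentCoordChange 𝓘(ℝ, V) x₀ x x v) =
      fderiv ℝ (f ∘ (chartAt V x₀).symm) (chartAt V x₀ x) v := by
  have h1 : HasFDerivAt (chartAt V x ∘ (chartAt V x₀).symm)
      (tangentCoordChange 𝓘(ℝ, V) x₀ x x) (chartAt V x₀ x) := by
    have := hasFDerivWithinAt_tangentCoordChange (I := 𝓘(ℝ, V)) (x := x₀) (y := x) (z := x)
      ⟨by simpa using hx, by simp⟩
    simpa using this
  have h2 : HasFDerivAt (f ∘ (chartAt V x).symm) (mfderiv 𝓘(ℝ, V) 𝓘(ℝ, F) f x :)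
      ((chartAt V x ∘ (chartAt V x₀).symm) (chartAt V x₀ x)) := by
    have := hf.hasMFDerivAt.2
    simp only [modelWithCornersSelf_coe, range_id] at this
    rw [Function.comp_apply, (chartAt V x₀).left_inv hx]
    exact hasFDerivWithinAt_univ.1 this
  have h3 := h2.comp _ h1
  have h4 : f ∘ (chartAt V x₀).symm =ᶠ[𝓝 (chartAt V x₀ x)]
      (f ∘ (chartAt V x).symm) ∘ (chartAt V x ∘ (chartAt V x₀).symm) := by
    have := ((chartAt V x₀).symm.continuousAt (x := chartAt V x₀ x)
      ((chartAt V x₀).map_source hx)).preimage_mem_nhds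
      ((chartAt V x).open_source.mem_nhds (by
        rw [(chartAt V x₀).left_inv hx]; exact mem_chart_source _ _))
    filter_upwards [this] with q hq
    simp [(chartAt V x).left_inv hq]
  rw [h4.fderiv_eq, h3.fderiv]
  rfl

theorem proj_mem_chart_source {k r : ℕ} (h : r ≤ k) {x₀ x : Jet E Q k}
    (hx : x ∈ (chartAt (JetModel E k) x₀).source) :
    x.proj h ∈ (chartAt (JetModel E r) (x₀.proj h)).source := by
  change (x.proj h).base ∈ (chartAt E (x₀.proj h).base).source
  rw [base_proj, base_proj]
  exact hx

theorem chart_proj' {k r : ℕ} (h : r ≤ k) {x₀ x : Jet E Q k}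
    (hx : x ∈ (chartAt (JetModel E k) x₀).source) :
    chartAt (JetModel E r) (x₀.proj h) (x.proj h) = truncL h (chartAt (JetModel E k) x₀ x) :=
  chart_proj h x₀ x hx

theorem jet_chartAt_zero_mem {k : ℕ} {x₀ x y : Jet E Q k}
    (hy : y ∈ (chartAt (JetModel E k) x₀).source) (hy' : y ∈ (chartAt (JetModel E k) x).source) :
    (chartAt (JetModel E k) x₀ y) 0 ∈
      ((chartAt E x₀.base).symm.trans (chartAt E x.base)).source := by
  rw [jet_chartAt_apply, jetCoord_zero]
  have h1 : y.base ∈ (chartAt E x₀.base).source := hy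
  have h2 : y.base ∈ (chartAt E x.base).source := hy'
  simp [h1, h2]

theorem tangentCoordChange_eq_fderiv_prolong {k : ℕ} {x₀ x y : Jet E Q k}
    (hy : y ∈ (chartAt (JetModel E k) x₀).source) (hy' : y ∈ (chartAt (JetModel E k) x).source) :
    tangentCoordChange 𝓘(ℝ, JetModel E k) x₀ x y =
      fderiv ℝ (prolong k (chartAt E x.base ∘ (chartAt E x₀.base).symm))
        (chartAt (JetModel E k) x₀ y) := by
  rw [tangentCoordChange_def]
  simp only [modelWithCornersSelf_coe, range_id, fderivWithin_univ]
  have h1 : (extChartAt 𝓘(ℝ, JetModel E k) x ∘ (extChartAt 𝓘(ℝ, JetModel E k) x₀).symm) =ᶠ[𝓝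
      (extChartAt 𝓘(ℝ, JetModel E k) x₀ y)]
      prolong k (chartAt E x.base ∘ (chartAt E x₀.base).symm) := by
    filter_upwards [((isOpen_transition _ _).preimage
      (continuous_apply (0 : Fin (k + 1)))).mem_nhds (jet_chartAt_zero_mem hy hy')] with q hq
    refine eqOn_jetChart_trans (chart_mem_atlas E x₀.base) (chart_mem_atlas E x.base) ?_
    rw [jetChart_trans_source]
    exact hq
  rw [h1.fderiv_eq]
  rfl

theorem chartAt_eq_prolong {k : ℕ} {x₀ x y : Jet E Q k}
    (hy : y ∈ (chartAt (JetModel E k) x₀).source) (hy' : y ∈ (chartAt (JetModel E k) x).source) :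
    chartAt (JetModel E k) x y = prolong k (chartAt E x.base ∘ (chartAt E x₀.base).symm)
      (chartAt (JetModel E k) x₀ y) :=
  jetCoord_transition k (chart_mem_atlas E _) (chart_mem_atlas E _) y hy hy'

theorem contDiffOn_chart_transition (x₀ x : Q) :
    ContDiffOn ℝ ∞ (chartAt E x ∘ (chartAt E x₀).symm)
      ((chartAt E x₀).symm.trans (chartAt E x)).source :=
  contDiffOn_transition (chart_mem_atlas E x₀) (chart_mem_atlas E x)

theorem truncL_tangentCoordChange {k r : ℕ} (h : r ≤ k) {x₀ x : Jet E Q k}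
    (hx : x ∈ (chartAt (JetModel E k) x₀).source) (v : JetModel E k) :
    truncL h (tangentCoordChange 𝓘(ℝ, JetModel E k) x₀ x x v) =
      tangentCoordChange 𝓘(ℝ, JetModel E r) (x₀.proj h) (x.proj h) (x.proj h) (truncL h v) := by
  rw [tangentCoordChange_eq_fderiv_prolong hx (mem_chart_source _ x),
    tangentCoordChange_eq_fderiv_prolong (proj_mem_chart_source h hx) (mem_chart_source _ _),
    truncL_fderiv_prolong h (isOpen_transition _ _) (contDiffOn_chart_transition _ _)
      (jet_chartAt_zero_mem hx (mem_chart_source _ x)), chart_proj' h hx, base_proj, base_proj]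

/-! ### Smoothness of the Lagrangian form -/

/-- A 1-form is smooth if its coefficients in natural coordinates are. -/
def IsSmoothForm {m : ℕ} (θ : OneForm E Q m) : Prop :=
  ∀ x₀ : Jet E Q m, ContMDiffOn 𝓘(ℝ, JetModel E m) 𝓘(ℝ, JetModel E m →L[ℝ] ℝ) ∞
    (formCoeff θ x₀) (chartAt (JetModel E m) x₀).source

theorem formCoeff_apply {m : ℕ} (θ : OneForm E Q m) (x₀ x : Jet E Q m) (v : JetModel E m) :
    formCoeff θ x₀ x v = θ x (tangentCoordChange 𝓘(ℝ, JetModel E m) x₀ x x v) := rfl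

theorem formCoeff_eq_comp {m : ℕ} (θ : OneForm E Q m) {x₀ x y : Jet E Q m}
    (hy : y ∈ (chartAt (JetModel E m) x₀).source) (hy' : y ∈ (chartAt (JetModel E m) x).source) :
    formCoeff θ x₀ y =
      (formCoeff θ x y).comp (tangentCoordChange 𝓘(ℝ, JetModel E m) x₀ x y) := by
  ext v
  rw [ContinuousLinearMap.comp_apply, formCoeff_apply, formCoeff_apply, tangentCoordChange_comp]
  simp [hy, hy']

/-- Since `J_r` commutes with coordinate changes, its matrix in the chart at `x₀` is the constant
`verticalL`, so the coefficients are first derivatives of `f` composed with a constant map. -/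
theorem isSmoothForm_verticalDiff {k : ℕ} (r : ℕ) {f : Jet E Q k → ℝ}
    (hf : ContMDiff 𝓘(ℝ, JetModel E k) 𝓘(ℝ, ℝ) ∞ f) : IsSmoothForm (verticalDiff r f) := by
  intro x₀
  have h1 : ContDiffOn ℝ ∞ (f ∘ (chartAt (JetModel E k) x₀).symm)
      (chartAt (JetModel E k) x₀).target := contMDiffOn_chart_source_iff.1 hf.contMDiffOn
  have h2 : ContDiffOn ℝ ∞ (fun q => (fderiv ℝ (f ∘ (chartAt (JetModel E k) x₀).symm) q).comp
      (verticalL E k r)) (chartAt (JetModel E k) x₀).target :=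
    (h1.fderiv_of_isOpen (chartAt (JetModel E k) x₀).open_target (by simp)).clm_comp
      contDiffOn_const
  refine (h2.contMDiffOn.comp (contMDiffOn_chart (I := 𝓘(ℝ, JetModel E k)))
    fun q hq => (chartAt (JetModel E k) x₀).map_source hq).congr fun x hx => ?_
  ext v
  rw [Function.comp_apply, ContinuousLinearMap.comp_apply, ← mfderiv_comp_tangentCoordChange
    (hf.mdifferentiableAt (by simp)) hx, tangentCoordChange_eq_fderiv_prolong hx
    (mem_chart_source _ x), fderiv_prolong_verticalL (isOpen_transition _ _)
    (contDiffOn_chart_transition _ _) (jet_chartAt_zero_mem hx (mem_chart_source _ x)),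
    ← tangentCoordChange_eq_fderiv_prolong hx (mem_chart_source _ x)]
  rfl

/-- By `shiftL_prolong`, the canonical injection is the shift of coordinates in the chart at `x₀`
too, not only in the preferred chart used to compute it. -/
theorem totalDeriv_eq {F : Type*} [NormedAddCommGroup F] [NormedSpace ℝ F] {m : ℕ}
    {f : Jet E Q m → F} {x₀ x : Jet E Q (m + 1)}
    (hx : x ∈ (chartAt (JetModel E (m + 1)) x₀).source)
    (hf : MDifferentiableAt 𝓘(ℝ, JetModel E m) 𝓘(ℝ, F) f (x.proj (Nat.le_succ m))) :
    totalDeriv f x = fderiv ℝ (f ∘ (chartAt (JetModel E m) (x₀.proj (Nat.le_succ m))).symm)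
      (truncL (Nat.le_succ m) (chartAt (JetModel E (m + 1)) x₀ x))
      (shiftL (chartAt (JetModel E (m + 1)) x₀ x)) := by
  have hx' := proj_mem_chart_source (Nat.le_succ m) hx
  rw [← chart_proj' (Nat.le_succ m) hx, ← mfderiv_comp_tangentCoordChange hf hx']
  have h1 : tangentCoordChange 𝓘(ℝ, JetModel E m) (x₀.proj (Nat.le_succ m))
      (x.proj (Nat.le_succ m)) (x.proj (Nat.le_succ m))
      (shiftL (chartAt (JetModel E (m + 1)) x₀ x)) =
      shiftL (chartAt (JetModel E (m + 1)) x x) := by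
    rw [chartAt_eq_prolong hx (mem_chart_source _ x), shiftL_prolong (isOpen_transition _ _)
      (contDiffOn_chart_transition _ _) (jet_chartAt_zero_mem hx (mem_chart_source _ x)),
      tangentCoordChange_eq_fderiv_prolong hx' (mem_chart_source _ _),
      chart_proj' (Nat.le_succ m) hx, base_proj, base_proj]
  rw [h1]
  unfold totalDeriv
  rw [canonicalInjection_fst]
  exact congrArg (mfderiv 𝓘(ℝ, JetModel E m) 𝓘(ℝ, F) f (x.proj (Nat.le_succ m)))
    (canonicalInjection_snd m x)

/-- `formDeriv` is written at each point in that point's own chart; here its Leibniz formula is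
shown to hold in the chart at `x₀`. Smoothness of `θ` enters because the transformation law of its
coefficients has to be differentiated. -/
theorem formCoeff_formDeriv {m : ℕ} {θ : OneForm E Q m} (hθ : IsSmoothForm θ)
    {x₀ x : Jet E Q (m + 1)} (hx : x ∈ (chartAt (JetModel E (m + 1)) x₀).source) :
    formCoeff (formDeriv θ) x₀ x =
      (totalDeriv (formCoeff θ (x₀.proj (Nat.le_succ m))) x).comp (truncL (Nat.le_succ m)) +
      (formCoeff θ (x₀.proj (Nat.le_succ m)) (x.proj (Nat.le_succ m))).comp shiftL := by
  set h := Nat.le_succ m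
  have hx' := proj_mem_chart_source h hx
  have hxx := mem_chart_source (JetModel E m) (x.proj h)
  set q := chartAt (JetModel E (m + 1)) x₀ x with hq
  set φ := chartAt (JetModel E m) (x₀.proj h) with hφ
  set ψ := chartAt E x.base ∘ (chartAt E x₀.base).symm with hψ
  have hq0 := jet_chartAt_zero_mem hx (mem_chart_source _ x)
  have hy : φ (x.proj h) = truncL h q := chart_proj' h hx
  have hd (y₀ : Jet E Q m) (hy₀ : x.proj h ∈ (chartAt (JetModel E m) y₀).source) :
      ContMDiffAt 𝓘(ℝ, JetModel E m) 𝓘(ℝ, JetModel E m →L[ℝ] ℝ) ∞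
        (formCoeff θ y₀) (x.proj h) :=
    (hθ y₀).contMDiffAt ((chartAt (JetModel E m) y₀).open_source.mem_nhds hy₀)
  have hsymm : φ.symm (truncL h q) = x.proj h := by rw [← hy, φ.left_inv hx']
  have hg : DifferentiableAt ℝ (formCoeff θ (x.proj h) ∘ φ.symm) (truncL h q) := by
    have h1 : ContMDiffAt 𝓘(ℝ, JetModel E m) 𝓘(ℝ, JetModel E m) ∞ φ.symm (truncL h q) :=
      (contMDiffOn_chart_symm (I := 𝓘(ℝ, JetModel E m))).contMDiffAt
        (φ.open_target.mem_nhds (hy ▸ φ.map_source hx'))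
    have h2 : ContMDiffAt 𝓘(ℝ, JetModel E m) 𝓘(ℝ, JetModel E m →L[ℝ] ℝ) ∞
        (formCoeff θ (x.proj h)) (φ.symm (truncL h q)) := by
      rw [hsymm]
      exact hd _ hxx
    exact ((h2.comp (truncL h q) h1).contDiffAt).differentiableAt (by simp)
  have hD : DifferentiableAt ℝ (fderiv ℝ (prolong m ψ)) (truncL h q) :=
    ((contDiffAt_prolong (k := m) (q := truncL h q) ((contDiffOn_chart_transition _ _).contDiffAt
      ((isOpen_transition _ _).mem_nhds hq0))).fderiv_right
      (m := ∞) (by simp)).differentiableAt (by simp)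
  -- The transformation law of the coefficients is needed on a neighbourhood, since its derivative
  -- is taken next.
  have hev : formCoeff θ (x₀.proj h) ∘ φ.symm =ᶠ[𝓝 (truncL h q)]
      fun y => ((formCoeff θ (x.proj h) ∘ φ.symm) y).comp (fderiv ℝ (prolong m ψ) y) := by
    have h1 := (φ.symm.continuousAt (x := truncL h q)
      (hy ▸ φ.map_source hx')).preimage_mem_nhds
      ((chartAt (JetModel E m) (x.proj h)).open_source.mem_nhds (by rw [hsymm]; exact hxx))
    filter_upwards [h1, φ.open_target.mem_nhds (hy ▸ φ.map_source hx')] with y hy1 hy2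
    rw [Function.comp_apply, formCoeff_eq_comp θ (φ.map_target hy2) hy1,
      tangentCoordChange_eq_fderiv_prolong (φ.map_target hy2) hy1, base_proj, base_proj,
      φ.right_inv hy2]
    rfl
  have hval : formCoeff θ (x₀.proj h) (x.proj h) =
      (formCoeff θ (x.proj h) (x.proj h)).comp (fderiv ℝ (prolong m ψ) (truncL h q)) := by
    have := hev.self_of_nhds
    simpa only [Function.comp_apply, hsymm] using this
  have hder := (hg.hasFDerivAt.clm_comp hD.hasFDerivAt).fderiv
  ext w
  change totalDeriv (formCoeff θ (x.proj h)) x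
      (truncL h (tangentCoordChange 𝓘(ℝ, JetModel E (m + 1)) x₀ x x w)) +
    formCoeff θ (x.proj h) (x.proj h)
      (shiftL (tangentCoordChange 𝓘(ℝ, JetModel E (m + 1)) x₀ x x w)) =
    totalDeriv (formCoeff θ (x₀.proj h)) x (truncL h w) +
      formCoeff θ (x₀.proj h) (x.proj h) (shiftL w)
  rw [totalDeriv_eq hx ((hd _ hxx).mdifferentiableAt (by simp)),
    totalDeriv_eq hx ((hd _ hx').mdifferentiableAt (by simp)), ← hq, hev.fderiv_eq, hder, hval,
    tangentCoordChange_eq_fderiv_prolong hx (mem_chart_source _ x),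
    truncL_fderiv_prolong h (isOpen_transition _ _) (contDiffOn_chart_transition _ _) hq0,
    shiftL_fderiv_prolong (isOpen_transition _ _) (contDiffOn_chart_transition _ _) hq0]
  simp only [Function.comp_apply, hsymm, ContinuousLinearMap.comp_apply, map_add, ← hq]
  simp only [add_apply, ContinuousLinearMap.comp_apply,
    ContinuousLinearMap.compL_apply, ContinuousLinearMap.flip_apply]
  -- The second derivative of the prolongation occurs on both sides: on the left from shifting the
  -- transformed vector, on the right from differentiating the transformation law. Only reordering
  -- is left.
  exact (add_left_comm _ _ _).trans (add_assoc _ _ _).symm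

theorem isSmoothForm_formDeriv {m : ℕ} {θ : OneForm E Q m} (hθ : IsSmoothForm θ) :
    IsSmoothForm (formDeriv θ) := by
  intro x₀
  set h := Nat.le_succ m
  set φ := chartAt (JetModel E m) (x₀.proj h) with hφ
  set g := formCoeff θ (x₀.proj h) ∘ φ.symm
  have hg : ContDiffOn ℝ ∞ g φ.target := contMDiffOn_chart_source_iff.1 (hθ _)
  have htr : MapsTo (truncL h) (chartAt (JetModel E (m + 1)) x₀).target φ.target := by
    intro q hq
    have := chart_proj' h ((chartAt (JetModel E (m + 1)) x₀).map_target hq)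
    rw [(chartAt (JetModel E (m + 1)) x₀).right_inv hq] at this
    rw [← this]
    exact φ.map_source (proj_mem_chart_source h ((chartAt (JetModel E (m + 1)) x₀).map_target hq))
  have htrs : ContDiffOn ℝ ∞ (truncL h : JetModel E (m + 1) →L[ℝ] JetModel E m)
      (chartAt (JetModel E (m + 1)) x₀).target := 
    (ContinuousLinearMap.contDiff (𝕜 := ℝ) (E := JetModel E (m + 1)) (F := JetModel E m)
      (truncL h)).contDiffOn
  have h1 : ContDiffOn ℝ ∞ (fun q : JetModel E (m + 1) =>
      (fderiv ℝ g (truncL h q) (shiftL q)).comp (truncL h) + (g (truncL h q)).comp shiftL)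
      (chartAt (JetModel E (m + 1)) x₀).target :=
    ((((hg.fderiv_of_isOpen φ.open_target (by simp)).comp htrs htr).clm_apply
      (ContinuousLinearMap.contDiff (𝕜 := ℝ) (E := JetModel E (m + 1)) (F := JetModel E m)
        shiftL).contDiffOn).clm_comp contDiffOn_const).add
      ((hg.comp htrs htr).clm_comp contDiffOn_const)
  refine (h1.contMDiffOn.comp (contMDiffOn_chart (I := 𝓘(ℝ, JetModel E (m + 1))))
    fun q hq => (chartAt (JetModel E (m + 1)) x₀).map_source hq).congr fun x hx => ?_
  have hx' := proj_mem_chart_source h hx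
  rw [formCoeff_formDeriv hθ hx, totalDeriv_eq hx (((hθ (x₀.proj h)).contMDiffAt
    (φ.open_source.mem_nhds hx')).mdifferentiableAt (by simp))]
  simp only [Function.comp_apply, g]
  rw [← chart_proj' h hx, φ.left_inv hx']

theorem isSmoothForm_formDerivIter {m : ℕ} {θ : OneForm E Q m} (hθ : IsSmoothForm θ) :
    ∀ s, IsSmoothForm (formDerivIter θ s)
  | 0 => hθ
  | s + 1 => isSmoothForm_formDeriv (isSmoothForm_formDerivIter hθ s)

theorem formCoeff_pullbackForm {k r : ℕ} (h : r ≤ k) (θ : OneForm E Q r) {x₀ x : Jet E Q k}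
    (hx : x ∈ (chartAt (JetModel E k) x₀).source) :
    formCoeff (pullbackForm h θ) x₀ x =
      (formCoeff θ (x₀.proj h) (x.proj h)).comp (truncL h) := by
  ext v
  have h1 : mfderiv 𝓘(ℝ, JetModel E k) 𝓘(ℝ, JetModel E r) (Jet.proj h) x
      (tangentCoordChange 𝓘(ℝ, JetModel E k) x₀ x x v) =
      tangentCoordChange 𝓘(ℝ, JetModel E r) (x₀.proj h) (x.proj h) (x.proj h) (truncL h v) := by
    rw [mfderiv_proj]
    exact truncL_tangentCoordChange h hx v
  exact congrArg (θ (x.proj h)) h1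

theorem contMDiffOn_clm_comp_const {V V₁ V₂ M : Type*} [NormedAddCommGroup V] [NormedSpace ℝ V]
    [TopologicalSpace M] [ChartedSpace V M] [NormedAddCommGroup V₁] [NormedSpace ℝ V₁]
    [NormedAddCommGroup V₂] [NormedSpace ℝ V₂] {f : M → V₁ →L[ℝ] ℝ} {s : Set M}
    (hf : ContMDiffOn 𝓘(ℝ, V) 𝓘(ℝ, V₁ →L[ℝ] ℝ) ∞ f s) (A : V₂ →L[ℝ] V₁) :
    ContMDiffOn 𝓘(ℝ, V) 𝓘(ℝ, V₂ →L[ℝ] ℝ) ∞ (fun x => (f x).comp A) s :=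
  (contDiff_id.clm_comp contDiff_const).contMDiff.comp_contMDiffOn hf

theorem mapsTo_proj_chart_source {k r : ℕ} (h : r ≤ k) (x₀ : Jet E Q k) :
    MapsTo (Jet.proj h) (chartAt (JetModel E k) x₀).source
      (chartAt (JetModel E r) (x₀.proj h)).source := by
  intro x hx
  exact proj_mem_chart_source h hx

theorem isSmoothForm_pullbackForm {k r : ℕ} (h : r ≤ k) {θ : OneForm E Q r}
    (hθ : IsSmoothForm θ) : IsSmoothForm (pullbackForm h θ) := by
  intro x₀
  have h1 : ContMDiffOn 𝓘(ℝ, JetModel E k) 𝓘(ℝ, JetModel E r →L[ℝ] ℝ) ∞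
      (fun x => formCoeff θ (x₀.proj h) (x.proj h)) (chartAt (JetModel E k) x₀).source :=
    (hθ (x₀.proj h)).comp (contMDiff_proj h).contMDiffOn (mapsTo_proj_chart_source h x₀)
  exact (contMDiffOn_clm_comp_const h1 (truncL h)).congr fun x hx =>
    formCoeff_pullbackForm h θ hx

theorem isSmoothForm_sum {m : ℕ} {ι : Type*} (s : Finset ι) (a : ι → ℝ) {θ : ι → OneForm E Q m}
    (hθ : ∀ i ∈ s, IsSmoothForm (θ i)) : IsSmoothForm (∑ i ∈ s, a i • θ i) := by
  intro x₀
  have h1 : ContMDiffOn 𝓘(ℝ, JetModel E m) 𝓘(ℝ, JetModel E m →L[ℝ] ℝ) ∞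
      (fun x => ∑ i ∈ s, a i • formCoeff (θ i) x₀ x) (chartAt (JetModel E m) x₀).source :=
    contMDiffOn_finsetSum fun i hi =>
      ((contDiff_const_smul (a i)).contMDiff).comp_contMDiffOn (hθ i hi x₀)
  refine h1.congr fun x _ => ?_
  ext v
  rw [formCoeff_apply, Finset.sum_apply, _root_.sum_apply]
  exact _root_.sum_apply (F := TangentSpace 𝓘(ℝ, JetModel E m) x →L[ℝ] ℝ) _ _ _

theorem isSmoothForm_lagrangianForm {k : ℕ} {L : Jet E Q k → ℝ}
    (hL : ContMDiff 𝓘(ℝ, JetModel E k) 𝓘(ℝ, ℝ) ∞ L) : IsSmoothForm (lagrangianForm L) :=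
  isSmoothForm_sum _ _ fun i _ => isSmoothForm_pullbackForm _
    (isSmoothForm_formDerivIter (isSmoothForm_verticalDiff (i + 1) hL) i)

/-! ### Manifold structures transported along a homeomorphism -/

section transport
variable {V B G : Type*} [NormedAddCommGroup V] [NormedSpace ℝ V] [TopologicalSpace B]
  [ChartedSpace V B] [TopologicalSpace G]

/-- The charted space structure obtained by pulling back charts along a homeomorphism. -/
abbrev comapChartedSpace (e : G ≃ₜ B) : ChartedSpace V G where
  atlas := (fun φ => e.toOpenPartialHomeomorph.trans φ) '' atlas V B
  chartAt g := e.toOpenPartialHomeomorph.trans (chartAt V (e g))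
  mem_chart_source g := by simp
  chart_mem_atlas g := mem_image_of_mem _ (chart_mem_atlas V (e g))

/-- The homeomorphism cancels in each change of charts, leaving one of `B`. -/
theorem isManifold_comapChartedSpace [IsManifold 𝓘(ℝ, V) ∞ B] (e : G ≃ₜ B) :
    letI : ChartedSpace V G := comapChartedSpace e
    IsManifold 𝓘(ℝ, V) ∞ G := by
  let _ : ChartedSpace V G := comapChartedSpace e
  refine { compatible := ?_ }
  rintro _ _ ⟨φ, hφ, rfl⟩ ⟨φ', hφ', rfl⟩
  refine (contDiffGroupoid ∞ 𝓘(ℝ, V)).mem_of_eqOnSource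
    ((contDiffGroupoid ∞ 𝓘(ℝ, V)).compatible hφ hφ') ⟨?_, ?_⟩
  · simp [preimage_preimage]
  · intro x _
    simp

theorem trans_mem_maximalAtlas {H M : Type*} [TopologicalSpace H] [TopologicalSpace M]
    [ChartedSpace H M] {𝒢 : StructureGroupoid H} {φ : OpenPartialHomeomorph M H}
    (hφ : φ ∈ 𝒢.maximalAtlas M) {g : OpenPartialHomeomorph H H} (hg : g ∈ 𝒢) :
    φ.trans g ∈ 𝒢.maximalAtlas M := by
  intro φ' hφ'
  rw [OpenPartialHomeomorph.trans_symm_eq_symm_trans_symm, OpenPartialHomeomorph.trans_assoc,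
    ← OpenPartialHomeomorph.trans_assoc φ'.symm]
  exact ⟨𝒢.trans (𝒢.symm hg) (hφ φ' hφ').1, 𝒢.trans (hφ φ' hφ').2 hg⟩

end transport

/-! ### Smooth sections of vector bundles are immersions -/

section graph
variable {V F : Type*} [NormedAddCommGroup V] [NormedSpace ℝ V] [NormedAddCommGroup F]
  [NormedSpace ℝ F]

/-- The local shear `(u, a) ↦ (u, a - f u)`. -/
def shear {f : V → F} {A : Set V} (hA : IsOpen A) (hf : ContinuousOn f A) :
    OpenPartialHomeomorph (ModelProd V F) (ModelProd V F) where
  toFun x := (x.1, x.2 - f x.1)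
  invFun x := (x.1, x.2 + f x.1)
  source := A ×ˢ univ
  target := A ×ˢ univ
  map_source' x hx := ⟨hx.1, mem_univ _⟩
  map_target' x hx := ⟨hx.1, mem_univ _⟩
  left_inv' x _ := by simp
  right_inv' x _ := by simp
  open_source := hA.prod isOpen_univ
  open_target := hA.prod isOpen_univ
  continuousOn_toFun := continuousOn_fst.prodMk
    (continuousOn_snd.sub (hf.comp continuousOn_fst fun _ hx => hx.1))
  continuousOn_invFun := continuousOn_fst.prodMk
    (continuousOn_snd.add (hf.comp continuousOn_fst fun _ hx => hx.1))

theorem shear_mem_contDiffGroupoid {f : V → F} {A : Set V} (hA : IsOpen A)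
    (hf : ContDiffOn ℝ ∞ f A) : shear hA hf.continuousOn ∈
      contDiffGroupoid ∞ (𝓘(ℝ, V).prod 𝓘(ℝ, F)) := by
  have h1 : ContDiffOn ℝ ∞ (fun x : V × F => f x.1) (A ×ˢ univ) :=
    hf.comp contDiffOn_fst fun _ hx => hx.1
  rw [contDiffGroupoid, mem_groupoid_of_pregroupoid]
  constructor
  · refine ContDiffOn.mono (s := A ×ˢ univ) ?_ fun x hx => hx.1
    exact contDiffOn_fst.prodMk (contDiffOn_snd.sub h1)
  · refine ContDiffOn.mono (s := A ×ˢ univ) ?_ fun x hx => hx.1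
    exact contDiffOn_fst.prodMk (contDiffOn_snd.add h1)

variable {B : Type*} [TopologicalSpace B] [ChartedSpace V B] [IsManifold 𝓘(ℝ, V) ∞ B]
  {X : B → Type*} [∀ b, AddCommMonoid (X b)] [∀ b, Module ℝ (X b)]
  [TopologicalSpace (Bundle.TotalSpace F X)] [∀ b, TopologicalSpace (X b)] [FiberBundle F X]
  [VectorBundle ℝ F X] [ContMDiffVectorBundle ∞ F X 𝓘(ℝ, V)]

/-- The image of a smooth section, parametrized by a space homeomorphic to the base, is immersed:
in a vector bundle chart it is straightened by a shear. -/
theorem isImmersion_section_comp {s : ∀ b, X b}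
    (hs : ContMDiff 𝓘(ℝ, V) (𝓘(ℝ, V).prod 𝓘(ℝ, F)) ∞ fun b => Bundle.TotalSpace.mk' F b (s b))
    {G : Type*} [TopologicalSpace G] (e : G ≃ₜ B) :
    letI : ChartedSpace V G := comapChartedSpace e
    Manifold.IsImmersion 𝓘(ℝ, V) (𝓘(ℝ, V).prod 𝓘(ℝ, F)) ∞
      fun g => Bundle.TotalSpace.mk' F (e g) (s (e g)) := by
  let _ : ChartedSpace V G := comapChartedSpace e
  have : IsManifold 𝓘(ℝ, V) ∞ G := isManifold_comapChartedSpace e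
  refine Manifold.IsImmersionOfComplement.isImmersion (F := F) fun g => ?_
  set b := e g
  set t := trivializationAt F X b with ht
  set φ := chartAt V b with hφ
  set A : Set V := φ.target ∩ φ.symm ⁻¹' t.baseSet with hA
  have hAo : IsOpen A := φ.isOpen_inter_preimage_symm t.open_baseSet
  set f : V → F := fun u => (t (Bundle.TotalSpace.mk' F (φ.symm u) (s (φ.symm u)))).2 with hf
  have hfs : ContDiffOn ℝ ∞ f A := by
    have h1 : ContMDiffOn 𝓘(ℝ, V) (𝓘(ℝ, V).prod 𝓘(ℝ, F)) ∞
        (fun u => Bundle.TotalSpace.mk' F (φ.symm u) (s (φ.symm u))) A :=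
      hs.comp_contMDiffOn ((contMDiffOn_chart_symm (I := 𝓘(ℝ, V))).mono inter_subset_left)
    exact ((t.contMDiffOn_iff fun u hu => t.mem_source.2 hu.2).1 h1).2.contDiffOn
  set w₀ : Bundle.TotalSpace F X := Bundle.TotalSpace.mk' F b (s b)
  -- In the bundle chart the section is `u ↦ (u, f u)`; the shear turns it into `u ↦ (u, 0)`, the
  -- normal form of an immersion with complement the fibre `F`.
  set ψ := (chartAt (ModelProd V F) w₀).trans (shear hAo hfs.continuousOn) with hψ
  have hchart : ∀ w : Bundle.TotalSpace F X, w.proj ∈ t.baseSet →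
      chartAt (ModelProd V F) w₀ w = (φ w.proj, (t w).2) := by
    intro w hw
    rw [FiberBundle.chartedSpace_chartAt]
    exact Prod.ext (congrArg φ (t.coe_fst' hw)) rfl
  have hsrc : ∀ w : Bundle.TotalSpace F X, w.proj ∈ t.baseSet → w.proj ∈ φ.source →
      w ∈ ψ.source := by
    intro w hw hw'
    have h1 : w ∈ (chartAt (ModelProd V F) w₀).source := by
      rw [FiberBundle.chartedSpace_chartAt]
      refine ⟨t.mem_source.2 hw, ?_, mem_univ _⟩
      change (t w).1 ∈ φ.source
      rwa [t.coe_fst' hw]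
    refine ⟨h1, ?_⟩
    rw [mem_preimage]
    change (chartAt (ModelProd V F) w₀ w).1 ∈ A ∧ _
    rw [hchart w hw]
    exact ⟨⟨φ.map_source hw', by rwa [mem_preimage, φ.left_inv hw']⟩, mem_univ _⟩
  -- The restriction to the trivializing set makes the section map the whole chart domain into
  -- `ψ.source`.
  set ρ := (e.toOpenPartialHomeomorph.trans φ).restr (e ⁻¹' t.baseSet) with hρ
  have hρs : ρ.source = e ⁻¹' (φ.source ∩ t.baseSet) := by
    rw [hρ, OpenPartialHomeomorph.restr_source' _ _ (t.open_baseSet.preimage e.continuous)]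
    simp [preimage_inter]
  have hbb : b ∈ φ.source ∩ t.baseSet :=
    ⟨mem_chart_source V b, FiberBundle.mem_baseSet_trivializationAt F X b⟩
  refine Manifold.IsImmersionAtOfComplement.mk_of_charts (ContinuousLinearEquiv.refl ℝ (V × F))
    ρ ψ ?_ ?_ ?_ ?_ ?_ ?_
  · rw [hρs]; exact hbb
  · exact hsrc _ hbb.2 hbb.1
  · refine restr_mem_maximalAtlas _ ?_ (t.open_baseSet.preimage e.continuous)
    exact StructureGroupoid.subset_maximalAtlas _ (mem_image_of_mem _ (chart_mem_atlas V b))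
  · exact trans_mem_maximalAtlas (IsManifold.chart_mem_maximalAtlas w₀)
      (shear_mem_contDiffGroupoid hAo hfs)
  · intro x hx
    rw [hρs] at hx
    exact hsrc _ hx.2 hx.1
  · intro u hu
    have hu' : u ∈ ρ.target := by simpa using hu
    have h1 : ρ.symm u ∈ ρ.source := ρ.map_target hu'
    rw [hρs] at h1
    have h2 : φ (e (ρ.symm u)) = u := ρ.right_inv hu'
    set y := e (ρ.symm u) with hy
    have h3 : φ.symm u = y := by rw [← h2, φ.left_inv h1.1]
    change ψ (Bundle.TotalSpace.mk' F y (s y)) = (u, 0)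
    have h4 := hchart (Bundle.TotalSpace.mk' F y (s y)) h1.2
    change ((chartAt (ModelProd V F) w₀ (Bundle.TotalSpace.mk' F y (s y))).1,
      (chartAt (ModelProd V F) w₀ (Bundle.TotalSpace.mk' F y (s y))).2 - f
      (chartAt (ModelProd V F) w₀ (Bundle.TotalSpace.mk' F y (s y))).1) = (u, (0 : F))
    rw [h4]
    change (φ y, _ - f (φ y)) = _
    rw [h2, hf]
    simp only [Prod.mk.injEq, true_and]
    rw [h3, sub_self]

end graph

/-! ### The Legendre map as a smooth section -/

/-- The fibre component of the Legendre map, as a section of `W` over `T^(2k-1) Q`. -/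
def legendreCovector {k : ℕ} (L : Jet E Q k → ℝ) (p : Jet E Q (2 * k - 1)) :
    ((projMap (by omega) : C^∞⟮𝓘(ℝ, JetModel E (2 * k - 1)), Jet E Q (2 * k - 1);
      𝓘(ℝ, JetModel E (k - 1)), Jet E Q (k - 1)⟯) *ᵖ (Cotangent E Q (k - 1))) p :=
  (existsUnique_legendre L p).choose

/-- The section `p ↦ (p, FL(p))` of `W`, whose image is the graph of the Legendre map. -/
def legendreSection {k : ℕ} (L : Jet E Q k → ℝ) (p : Jet E Q (2 * k - 1)) : UnifiedSpace E Q k :=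
  Bundle.TotalSpace.mk' (JetModel E (k - 1) →L[ℝ] ℝ) p (legendreCovector L p)

/-- Extending `v` by zeros in the chart at `p₀` gives a tangent vector at `p` whose projection is
the one with components `v`, because truncation commutes with coordinate changes. The defining
property of `FL` applied to it gives the components of `FL(p)` in that fixed chart. -/
theorem legendreCovector_tangentCoordChange {k : ℕ} (hk : k - 1 ≤ 2 * k - 1)
    (L : Jet E Q k → ℝ) {p₀ p : Jet E Q (2 * k - 1)}
    (hp : p ∈ (chartAt (JetModel E (2 * k - 1)) p₀).source) (v : JetModel E (k - 1)) :
    (existsUnique_legendre L p).choose (tangentCoordChange 𝓘(ℝ, JetModel E (k - 1))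
      (p₀.proj hk) (p.proj hk) (p.proj hk) v) =
      formCoeff (lagrangianForm L) p₀ p (extendL (2 * k - 1) v) := by
  refine Eq.trans (congrArg (existsUnique_legendre L p).choose ?_)
    ((existsUnique_legendre L p).choose_spec.1
      (tangentCoordChange 𝓘(ℝ, JetModel E (2 * k - 1)) p₀ p p (extendL (2 * k - 1) v))).symm
  rw [mfderiv_proj]
  refine Eq.trans ?_ (truncL_tangentCoordChange hk hp _).symm
  congr 1
  funext i
  rw [truncL_apply, extendL_apply, dif_pos (by simp; omega)]

/-- The trivial line bundle contributes the identity, so the cotangent trivialization is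
precomposition with the tangent coordinate change. -/
theorem inCoordinates_cotangent {V B : Type*} [NormedAddCommGroup V] [NormedSpace ℝ V]
    [TopologicalSpace B] [ChartedSpace V B] [IsManifold 𝓘(ℝ, V) ∞ B] {x₀ x : B}
    (hx : x ∈ (chartAt V x₀).source)
    (α : TangentSpace 𝓘(ℝ, V) x →L[ℝ] Bundle.Trivial B ℝ x) (v : V) :
    ContinuousLinearMap.inCoordinates V (TangentSpace 𝓘(ℝ, V) : B → Type _) ℝ
      (Bundle.Trivial B ℝ) x₀ x x₀ x α v = α (tangentCoordChange 𝓘(ℝ, V) x₀ x x v) := by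
  have h1 : (trivializationAt ℝ (Bundle.Trivial B ℝ) x₀).continuousLinearMapAt ℝ x =
      ContinuousLinearMap.id ℝ ℝ := Bundle.Trivial.continuousLinearMapAt_trivialization ℝ B ℝ x
  rw [ContinuousLinearMap.inCoordinates, TangentBundle.symmL_trivializationAt_eq_core hx, h1]
  rfl

/-- The trivialization of `W` at `p₀` is that of the cotangent bundle at the projection of `p₀`. In
it the section is the coefficient map of `θ_L` in the chart at `p₀`, followed by restriction along
the constant `extendL`. -/
theorem contMDiff_legendreSection {k : ℕ} {L : Jet E Q k → ℝ}
    (hL : ContMDiff 𝓘(ℝ, JetModel E k) 𝓘(ℝ, ℝ) ∞ L) :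
    ContMDiff 𝓘(ℝ, JetModel E (2 * k - 1)) (unifiedModel E k) ∞
      (legendreSection L : Jet E Q (2 * k - 1) → UnifiedSpace E Q k) := by
  intro p₀
  have hk : k - 1 ≤ 2 * k - 1 := by omega
  rw [Bundle.contMDiffAt_totalSpace]
  refine ⟨contMDiffAt_id, ?_⟩
  have h1 := (contMDiffOn_clm_comp_const (isSmoothForm_lagrangianForm hL p₀)
    (extendL (2 * k - 1) : JetModel E (k - 1) →L[ℝ] JetModel E (2 * k - 1))).contMDiffAt
    ((chartAt (JetModel E (2 * k - 1)) p₀).open_source.mem_nhds (mem_chart_source _ p₀))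
  refine h1.congr_of_eventuallyEq ?_
  filter_upwards [(chartAt (JetModel E (2 * k - 1)) p₀).open_source.mem_nhds
    (mem_chart_source _ p₀)] with p hp
  change ContinuousLinearMap.inCoordinates (JetModel E (k - 1))
    (TangentSpace 𝓘(ℝ, JetModel E (k - 1)) : Jet E Q (k - 1) → Type _) ℝ
    (Bundle.Trivial (Jet E Q (k - 1)) ℝ) (p₀.proj hk) (p.proj hk) (p₀.proj hk) (p.proj hk)
    (existsUnique_legendre L p).choose = _
  have hp' := proj_mem_chart_source hk hp
  ext v
  refine Eq.trans ?_ (legendreCovector_tangentCoordChange hk L hp v)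
  exact inCoordinates_cotangent hp' _ v

/-- The base points of `pr₂ w` and `FL(pr₁ w)` agree by the construction of `W`, so the graph
condition only compares covectors in one fibre. -/
theorem mem_legendreGraph_iff {k : ℕ} {L : Jet E Q k → ℝ} {w : UnifiedSpace E Q k} :
    w ∈ legendreGraph L ↔ legendreSection L w.proj = w := by
  obtain ⟨p, α⟩ := w
  refine ⟨fun h => ?_, fun h => ?_⟩
  · have h1 : Bundle.TotalSpace.mk' (JetModel E (k - 1) →L[ℝ] ℝ)
        (E := Cotangent E Q (k - 1)) (p.proj (by omega)) α =
        Bundle.TotalSpace.mk' (JetModel E (k - 1) →L[ℝ] ℝ) (p.proj (by omega))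
          (existsUnique_legendre L p).choose := h
    have h2 := Bundle.TotalSpace.mk_inj.1 h1
    exact congrArg (Bundle.TotalSpace.mk' (JetModel E (k - 1) →L[ℝ] ℝ) p) h2.symm
  · rw [← h]
    rfl

/-- The graph of the Legendre map is homeomorphic to `T^(2k-1) Q` through `pr₁`. -/
def legendreGraphHomeomorph {k : ℕ} {L : Jet E Q k → ℝ}
    (hL : ContMDiff 𝓘(ℝ, JetModel E k) 𝓘(ℝ, ℝ) ∞ L) :
    legendreGraph L ≃ₜ Jet E Q (2 * k - 1) where
  toFun w := pr₁ w.val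
  invFun p := ⟨legendreSection L p, mem_legendreGraph_iff.2 rfl⟩
  left_inv w := Subtype.ext (mem_legendreGraph_iff.1 w.2)
  right_inv _ := rfl
  continuous_toFun := (FiberBundle.continuous_proj _ _).comp continuous_subtype_val
  continuous_invFun := (contMDiff_legendreSection hL).continuous.subtype_mk _

end HigherOrder
end

/-! ### The graph as a submanifold and its projection -/

open HigherOrder in
theorem mainTheorem9 {E : Type*} [NormedAddCommGroup E] [NormedSpace ℝ E] [FiniteDimensional ℝ E]
    {Q : Type*} [TopologicalSpace Q] [ChartedSpace E Q] [IsManifold 𝓘(ℝ, E) ∞ Q]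
    (k : ℕ) (hk : 1 ≤ k) (L : C^∞⟮𝓘(ℝ, JetModel E k), Jet E Q k; 𝓘(ℝ, ℝ), ℝ⟯) :
    -- `W_o = graph FL` is an embedded submanifold of `W`
    (∃ _ : ChartedSpace (JetModel E (2 * k - 1)) (legendreGraph (L : Jet E Q k → ℝ)),
      IsManifold 𝓘(ℝ, JetModel E (2 * k - 1)) ∞ (legendreGraph (L : Jet E Q k → ℝ)) ∧
      Manifold.IsSmoothEmbedding 𝓘(ℝ, JetModel E (2 * k - 1)) (unifiedModel E k) ∞
        (Subtype.val : legendreGraph (L : Jet E Q k → ℝ) → UnifiedSpace E Q k)) ∧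
    -- for any such submanifold structure, the restriction of `pr₁` to `W_o` is a diffeomorphism
    ∀ {F : Type*} [NormedAddCommGroup F] [NormedSpace ℝ F]
      [ChartedSpace F (legendreGraph (L : Jet E Q k → ℝ))]
      [IsManifold 𝓘(ℝ, F) ∞ (legendreGraph (L : Jet E Q k → ℝ))],
      Manifold.IsSmoothEmbedding 𝓘(ℝ, F) (unifiedModel E k) ∞
        (Subtype.val : legendreGraph (L : Jet E Q k → ℝ) → UnifiedSpace E Q k) →
      ∃ Φ : legendreGraph (L : Jet E Q k → ℝ) ≃ₘ^∞⟮𝓘(ℝ, F), 𝓘(ℝ, JetModel E (2 * k - 1))⟯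
          Jet E Q (2 * k - 1),
        ∀ w, Φ w = pr₁ w.val := by
  have hs := contMDiff_legendreSection L.contMDiff
  have hval (w : legendreGraph (L : Jet E Q k → ℝ)) : legendreSection L (pr₁ w.val) = w.val :=
    mem_legendreGraph_iff.1 w.2
  set e := legendreGraphHomeomorph L.contMDiff
  refine ⟨?_, fun {F} _ _ _ _ hj => ?_⟩
  · let _ : ChartedSpace (JetModel E (2 * k - 1)) (legendreGraph (L : Jet E Q k → ℝ)) :=
      comapChartedSpace e
    have h1 := isImmersion_section_comp (s := legendreCovector (L : Jet E Q k → ℝ)) hs e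
    exact ⟨_, isManifold_comapChartedSpace e, h1.congr (funext hval), .subtypeVal⟩
  · refine ⟨⟨e.toEquiv, ?_, ?_⟩, fun _ => rfl⟩
    · exact (Bundle.contMDiff_proj _).comp hj.contMDiff
    -- A continuous map into the source of an immersion is smooth as soon as its composite with the
    -- immersion is. Here the composite with `j_o` is the Legendre section, and continuity uses only
    -- the subspace topology.
    · exact (ContMDiff.iff_comp_isImmersion hj.isImmersion).2 ⟨e.symm.continuous, hs⟩
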